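/- **Lemma (Efficient spectral cleaning).** *Setting.* Let $\sigma$ be fixed. $X$ is a random symmetric $n\times n$ matrix whose entries on and above the diagonal are i.i.d. with mean $0$, variance $\frac1n$ and subgaussian parameter $\frac{\sigma}{\sqrt n}$, that is, $\mathbb E|X_{ij}|^k\le(\sigma/\sqrt n)^k\,k^{k/2}$ for all $k\in\mathbb N$. A matrix $Y$ is an $\varepsilon$-principal minor corruption of $X$ if there is $Q\subseteq[n]$ with $|Q|\le\varepsilon n$ such that $Y-X$ vanishes outside $Q\times Q$; and $\hat Y$ is an $\varepsilon$-restriction of $Y$ if it arises from $Y$ by zeroing out the rows and columns indexed by some $S\subseteq[n]$ with $|S|\le\varepsilon n$. *Algorithm.* Spectral cleaning with threshold $K\ge0$ takes a symmetric matrix $Y$, sets $\hat Y=Y$ and, while $\|\hat Y\|_{\mathrm{op}}>K$, takes a unit eigenvector $v$ of $\hat Y$ with eigenvalue of largest magnitude, samples $i\in[n]$ with probability $v_i^2$, and zeroes out the $i$-th row and column of $\hat Y$; it outputs $\hat Y$. Its implementation by power iteration takes, in each pass, instead of $v$ the vector $w=\hat Y^k g$ with $k=100(\lceil\log_2 n\rceil+1)$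 and $g$ uniform in $\{0,\dots,n^2\}^n$, continues only if $\|\hat Yw\|>K\|w\|$, and samples $i$ with probability $w_i^2/\|w\|^2$. Its running time is the number of its elementary steps (real arithmetic operations, comparisons, writes, counter updates and random draws, where sampling $i$ is charged $3n+1$ steps). *Claim.* There is a constant $C=C(\sigma)>0$ such that for every $\delta>0$ there is $N\in\mathbb N$ such that the following holds for all $n\ge N$ and all $\varepsilon$ with $\varepsilon n\ge N$ (in particular for every fixed $\varepsilon>0$ and all large $n$). Put $K=5\,\mathbb E\|X\|_{\mathrm{op}}$. With probability at least $1-\delta$ over $X$, for **every** symmetric $\varepsilon$-principal minor corruption $Y$ of $X$: 1. for every rule selecting top eigenvectors, spectral cleaning run on $Y$ with threshold $K$ outputs, with probability at least $1-\delta$ over its own randomness and after at most $4\varepsilon n$ executions of the loop body, a $4\varepsilon$-restriction $\hat Y$ of $Y$ with $\|\hat Y\|_{\mathrm{op}}\le C$; 2. the implementation by power iteration outputs, with probability at least $1-\delta$ over its own randomness and in time at most $C\,\varepsilon n^3\log n$, a $4\varepsilon$-restriction $\hat Y$ of $Y$ with $\|\hat Y\|_{\mathrm{op}}\le C$; 3.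 if $Y-X$ vanishes outside $Q\times Q$, and $\hat Y$ is $Y$ with the rows and columns in $S\subseteq[n]$ zeroed out and $\|\hat Y\|_{\mathrm{op}}>K$, then every unit top eigenvector $v$ of $\hat Y$ has $\sum_{i\in Q\setminus S}v_i^2\ge\frac12-\delta$; that is, each step of the algorithm removes a corrupted index with probability at least $\frac12-\delta$. -/

import Mathlib

open MeasureTheory ProbabilityTheory
open scoped ENNReal

noncomputable section

namespace SpectralCleaning

/-! ## Matrices: operator norm, corruptions, restrictions, top eigenvectors -/

/-- The spectral (Euclidean operator) norm of a real square matrix. -/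
def opNorm {n : ℕ} (A : Matrix (Fin n) (Fin n) ℝ) : ℝ :=
  ‖Matrix.toEuclideanCLM (n := Fin n) (𝕜 := ℝ) A‖

/-- `A` with the rows and columns indexed by `S` set to zero. -/
def zeroOut {n : ℕ} (S : Finset (Fin n)) (A : Matrix (Fin n) (Fin n) ℝ) :
    Matrix (Fin n) (Fin n) ℝ :=
  Matrix.of fun i j => if i ∈ S ∨ j ∈ S then 0 else A i j

/-- `B` is an `ε`-restriction of `A`. -/
def IsRestriction {n : ℕ} (ε : ℝ) (A B : Matrix (Fin n) (Fin n) ℝ) : Prop :=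
  ∃ S : Finset (Fin n), (S.card : ℝ) ≤ ε * n ∧ B = zeroOut S A

/-- `D` is supported on the principal minor with index set `Q`. -/
def SupportedOnMinor {n : ℕ} (Q : Finset (Fin n)) (D : Matrix (Fin n) (Fin n) ℝ) : Prop :=
  ∀ i j, ¬ (i ∈ Q ∧ j ∈ Q) → D i j = 0

/-- `Y` is an `ε`-principal minor corruption of `X`. -/
def IsPrincipalMinorCorruption {n : ℕ} (ε : ℝ) (X Y : Matrix (Fin n) (Fin n) ℝ) : Prop :=
  ∃ Q : Finset (Fin n), (Q.card : ℝ) ≤ ε * n ∧ SupportedOnMinor Q (Y - X)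

/-- `v` is a unit eigenvector of `A` whose eigenvalue has the largest magnitude among the real
eigenvalues of `A` (the matrix `A` is symmetric wherever this is used). -/
def IsTopEigenvector {n : ℕ} (A : Matrix (Fin n) (Fin n) ℝ) (v : Fin n → ℝ) : Prop :=
  ∑ i, v i ^ 2 = 1 ∧
    ∃ m : ℝ, A.mulVec v = m • v ∧
      ∀ (l : ℝ) (w : Fin n → ℝ), w ≠ 0 → A.mulVec w = l • w → |l| ≤ |m|

/-! ## The random matrix -/

/-- `Z` is `s`-subgaussian: it has mean zero and `E |Z| ^ k ≤ s ^ k * k ^ (k / 2)` for all `k`. -/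
def IsSubgaussian {Ω : Type*} [MeasurableSpace Ω] (P : Measure Ω) (Z : Ω → ℝ) (s : ℝ) : Prop :=
  ∫ ω, Z ω ∂P = 0 ∧
    ∀ k : ℕ, Integrable (fun ω => |Z ω| ^ k) P ∧
      ∫ ω, |Z ω| ^ k ∂P ≤ s ^ k * (k : ℝ) ^ ((k : ℝ) / 2)

/-- `X` is a random symmetric `n × n` matrix whose entries on and above the diagonal are i.i.d.,
with mean `0`, variance `1 / n` and subgaussian parameter `σ / √n`. -/
structure IsSymmetricIID {n : ℕ} {Ω : Type*} [MeasurableSpace Ω] (σ : ℝ) (P : Measure Ω)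
    (X : Ω → Matrix (Fin n) (Fin n) ℝ) : Prop where
  symm : ∀ ω, (X ω).IsSymm
  meas : ∀ i j, Measurable fun ω => X ω i j
  indep : iIndepFun (fun (p : {p : Fin n × Fin n // p.1 ≤ p.2}) ω => X ω p.1.1 p.1.2) P
  ident : ∀ i j k l, IdentDistrib (fun ω => X ω i j) (fun ω => X ω k l) P P
  var : ∀ i j, variance (fun ω => X ω i j) P = 1 / n
  subgaussian : ∀ i j, IsSubgaussian P (fun ω => X ω i j) (σ / √n)

/-! ## Step-counted computations

A real-number RAM: an arithmetic operation on reals, a comparison of two reals, the writing of a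
memory cell, an update of a loop counter, and the draw of a random integer each cost one step. -/

/-- A deterministic computation: its result and the number of its elementary steps. -/
structure Timed (α : Type) where
  val : α
  cost : ℕ

namespace Timed

def ret {α : Type} (a : α) : Timed α := ⟨a, 0⟩

/-- One elementary step with result `a`. -/
def step {α : Type} (a : α) : Timed α := ⟨a, 1⟩

def bind {α β : Type} (x : Timed α) (f : α → Timed β) : Timed β :=
  ⟨(f x.val).val, x.cost + (f x.val).cost⟩

/-- The loop `for i in [n] do w[i] := f i`; each write costs one step. -/
def forVec {n : ℕ} (f : Fin n → Timed ℝ) : Timed (Fin n → ℝ) :=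
  ⟨fun i => (f i).val, ∑ i, ((f i).cost + 1)⟩

/-- The loop `s := 0; for i in [n] do s := s + f i`; each addition costs one step. -/
def forSum {n : ℕ} (f : Fin n → Timed ℝ) : Timed ℝ :=
  ⟨∑ i, (f i).val, ∑ i, ((f i).cost + 1)⟩

end Timed

/-- A randomized computation: the joint law of its result and the number of its steps. -/
abbrev Rand (α : Type) : Type := PMF (α × ℕ)

namespace Rand

def ret {α : Type} (a : α) : Rand α := PMF.pure (a, 0)

def lift {α : Type} (x : Timed α) : Rand α := PMF.pure (x.val, x.cost)

/-- Draw from `p`, at the cost of `c` steps. -/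
def draw {α : Type} (c : ℕ) (p : PMF α) : Rand α := p.map fun a => (a, c)

/-- Run `x`, then `f` on its result; the steps add up. -/
def bind {α β : Type} (x : Rand α) (f : α → Rand β) : Rand β :=
  PMF.bind x fun a => (f a.1).map fun b => (b.1, a.2 + b.2)

end Rand

/-! ## The cleaning loop -/

theorem sum_sq_ne_zero {n : ℕ} {v : Fin n → ℝ} (hv : v ≠ 0) :
    ∑' i, ENNReal.ofReal (v i ^ 2) ≠ 0 := by
  obtain ⟨i, hi⟩ := Function.ne_iff.mp hv
  intro h
  have h1 := (ENNReal.tsum_eq_zero.mp h) i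
  rw [ENNReal.ofReal_eq_zero] at h1
  have h2 : 0 < v i ^ 2 := by
    have : v i ≠ 0 := hi
    positivity
  linarith

theorem sum_sq_ne_top {n : ℕ} (v : Fin n → ℝ) :
    ∑' i, ENNReal.ofReal (v i ^ 2) ≠ ∞ := by
  rw [tsum_fintype]
  exact (ENNReal.sum_lt_top.mpr fun i _ => ENNReal.ofReal_lt_top).ne

open Classical in
/-- An index `i` drawn with probability `v i ^ 2 / ∑ j, v j ^ 2`; there is none if `v = 0`. -/
def squareLaw {n : ℕ} (v : Fin n → ℝ) : PMF (Option (Fin n)) :=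
  if hv : v = 0 then PMF.pure none
  else (PMF.normalize (fun i => ENNReal.ofReal (v i ^ 2))
    (sum_sq_ne_zero hv) (sum_sq_ne_top v)).map some

/-- For a unit vector `v`, index `i` is drawn with probability `v i ^ 2`. -/
theorem squareLaw_apply {n : ℕ} {v : Fin n → ℝ} (hv : ∑ i, v i ^ 2 = 1) (i : Fin n) :
    squareLaw v (some i) = ENNReal.ofReal (v i ^ 2) := by
  have h0 : v ≠ 0 := by
    rintro rfl
    simp at hv
  have hs : ∑ i, ENNReal.ofReal (v i ^ 2) = 1 := by
    rw [← ENNReal.ofReal_sum_of_nonneg fun i _ => sq_nonneg (v i), hv, ENNReal.ofReal_one]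
  classical
  rw [squareLaw, dif_neg h0, PMF.map_apply, tsum_fintype, Finset.sum_eq_single i]
  · rw [if_pos rfl, PMF.normalize_apply, tsum_fintype, hs]
    simp
  · intro j _ hj
    rw [if_neg]
    intro h
    exact hj (Option.some.inj h).symm
  · simp

/-- The while loop on the current matrix. One pass tests the current matrix by `test`, which
either asks to stop (`none`) or selects an index (`some i`), whose row and column are then set to
zero at the cost of `c` steps. At most `T` tests are made; the result is `none` if the loop has
not stopped by then. -/
def cleanLoop {n : ℕ} (test : Matrix (Fin n) (Fin n) ℝ → Rand (Option (Fin n))) (c : ℕ) :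
    ℕ → Matrix (Fin n) (Fin n) ℝ → Rand (Option (Matrix (Fin n) (Fin n) ℝ))
  | 0, _ => Rand.ret none
  | T + 1, A =>
    Rand.bind (test A) fun r =>
      match r with
      | none => Rand.ret (some A)
      | some i => Rand.bind (Rand.lift ⟨zeroOut {i} A, c⟩) (cleanLoop test c T)

/-! ## Spectral cleaning with exact top eigenvectors -/

/-- Stop if `‖A‖ ≤ K`; otherwise sample an index from the squared top eigenvector `top A`. -/
def exactTest {n : ℕ} (top : Matrix (Fin n) (Fin n) ℝ → Fin n → ℝ) (K : ℝ)
    (A : Matrix (Fin n) (Fin n) ℝ) : Rand (Option (Fin n)) :=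
  open Classical in
  if opNorm A ≤ K then Rand.ret none else Rand.draw 0 (squareLaw (top A))

/-- Spectral cleaning with a rule `top` that returns a top eigenvector. Only the executions of the
loop body are counted, each as one step. No index is selected twice, so that `n + 1` tests
suffice. -/
def exactClean {n : ℕ} (top : Matrix (Fin n) (Fin n) ℝ → Fin n → ℝ) (K : ℝ)
    (Y : Matrix (Fin n) (Fin n) ℝ) : Rand (Option (Matrix (Fin n) (Fin n) ℝ)) :=
  cleanLoop (exactTest top K) 1 (n + 1) Y

/-! ## Spectral cleaning with power iteration -/

/-- The inner product, by `n` multiplications and `n` additions. -/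
def dotT {n : ℕ} (u v : Fin n → ℝ) : Timed ℝ := Timed.forSum fun i => Timed.step (u i * v i)

/-- The matrix-vector product, by `n` inner products. -/
def mulVecT {n : ℕ} (A : Matrix (Fin n) (Fin n) ℝ) (v : Fin n → ℝ) : Timed (Fin n → ℝ) :=
  Timed.forVec fun i => dotT (A i) v

/-- `k` rounds of `w := A w`; one more step per round for the loop counter. -/
def powerT {n : ℕ} (A : Matrix (Fin n) (Fin n) ℝ) : ℕ → (Fin n → ℝ) → Timed (Fin n → ℝ)
  | 0, w => Timed.ret w
  | k + 1, w => (Timed.step w).bind fun w => (mulVecT A w).bind (powerT A k)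

/-- The number `100 (⌈log₂ n⌉ + 1)` of rounds, charged with as many steps. -/
def roundsT (n : ℕ) : Timed ℕ := ⟨100 * (Nat.clog 2 n + 1), 100 * (Nat.clog 2 n + 1)⟩

open Classical in
/-- The test `‖A w‖ > K ‖w‖` (for `K ≥ 0`), done as `‖A w‖ ^ 2 > K * K * ‖w‖ ^ 2`. -/
def exceedsT {n : ℕ} (K : ℝ) (A : Matrix (Fin n) (Fin n) ℝ) (w : Fin n → ℝ) : Timed Bool :=
  (mulVecT A w).bind fun u =>
    (dotT u u).bind fun a =>
      (dotT w w).bind fun b =>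
        (Timed.step (K * K)).bind fun q =>
          (Timed.step (q * b)).bind fun r => Timed.step (decide (r < a))

/-- The start vector of the power iteration: independent uniform integers in `{0, …, n ^ 2}`. -/
def startLaw (n : ℕ) : PMF (Fin n → ℝ) :=
  (PMF.uniformOfFintype (Fin n → Fin (n ^ 2 + 1))).map fun g i => ((g i : ℕ) : ℝ)

/-- Run power iteration on `A` from a random start to get an approximate top eigenvector `w`.
Stop if `‖A w‖ ≤ K ‖w‖`; otherwise sample an index with probability proportional to `w i ^ 2`.
The sampling is charged `3 n + 1` steps (squares, partial sums, comparisons, one random draw). -/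
def powerTest {n : ℕ} (K : ℝ) (A : Matrix (Fin n) (Fin n) ℝ) : Rand (Option (Fin n)) :=
  Rand.bind (Rand.draw n (startLaw n)) fun g =>
    Rand.bind (Rand.lift (roundsT n)) fun k =>
      Rand.bind (Rand.lift (powerT A k g)) fun w =>
        Rand.bind (Rand.lift (exceedsT K A w)) fun b =>
          if b then Rand.draw (3 * n + 1) (squareLaw w) else Rand.ret none

/-- Spectral cleaning with power iteration, with all its steps counted: `n ^ 2` for the copy of
the input, the steps of every test, and `2 n` for every zeroing of a row and a column. -/
def powerClean {n : ℕ} (K : ℝ) (Y : Matrix (Fin n) (Fin n) ℝ) :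
    Rand (Option (Matrix (Fin n) (Fin n) ℝ)) :=
  Rand.bind (Rand.lift ⟨Y, n ^ 2⟩) (cleanLoop (powerTest K) (2 * n) (n + 1))

/-- The probability that the randomized computation `p` on input `Y` stops within `t` steps and
outputs a `4ε`-restriction of `Y` of operator norm at most `C`. -/
def successProb {n : ℕ} (p : Rand (Option (Matrix (Fin n) (Fin n) ℝ)))
    (Y : Matrix (Fin n) (Fin n) ℝ) (ε C t : ℝ) : ℝ≥0∞ :=
  p.toOuterMeasure
    {r | (r.2 : ℝ) ≤ t ∧ ∃ B, r.1 = some B ∧ IsRestriction (4 * ε) Y B ∧ opNorm B ≤ C}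

end SpectralCleaning

end

namespace SpectralCleaning

/-! ## Spectral facts about symmetric matrices -/

/-! Write `M` for the mean of `‖X‖`, so that `K = 5M`. Randomness of `X` enters only through the
event `‖X‖ ≤ 3M`; on it the argument is deterministic in `X` and covers every `Y` at once.

Rows of the cleaned matrix `A` outside `Q \ S` are zero or agree with `X` off `S`. Hence `A v` has
squared mass at most `‖X‖² ‖v‖²` there (`sum_sq_zeroOut_mulVec_compl_le`). For a unit top
eigenvector with `‖A‖ > 5M` this leaves mass at most `9/25` outside `Q \ S`, so a removal hits a
surviving corrupted index with probability at least `1/2`. The potential `2 ^ |Q \ S|` therefore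
shrinks by an expected factor `3/4` per removal, and `4 |Q|` removals suffice with high probability
(`cleanLoop_compl_goodOutcome_le`).

For power iteration, the squared norms of the iterates are log-convex, so the growth ratio never
decreases. If the start has overlap of order `n ^ (-1/2)` with a top eigenvector, logarithmically
many rounds make the ratio at least `0.81 ‖A‖²`. The test then detects `‖A‖ > 2K`, and the last
iterate `w = A w'` inherits the mass bound of the eigenvector with the constant `4/9`. A bad start
has probability at most `1 / (n² + 1)`, which survives a union bound over `n + 1` tests.

For the event `‖X‖ ≤ 3M`, the Efron–Stein inequality and sixth moments make the variance of `‖X‖`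
small, the second moment of `‖X‖` is at least `1`, so `M² ≥ 1/2`, and Chebyshev applies. A net and
exponential moments bound `M` by a constant depending on `σ`. -/

theorem opNorm_nonneg {n : ℕ} (A : Matrix (Fin n) (Fin n) ℝ) : 0 ≤ opNorm A := norm_nonneg _

theorem sum_sq_mulVec_le {n : ℕ} (A : Matrix (Fin n) (Fin n) ℝ) (v : Fin n → ℝ) :
    ∑ i, A.mulVec v i ^ 2 ≤ opNorm A ^ 2 * ∑ i, v i ^ 2 := by
  have h := (Matrix.toEuclideanCLM (n := Fin n) (𝕜 := ℝ) A).le_opNorm (WithLp.toLp 2 v)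
  have h2 := pow_le_pow_left₀ (norm_nonneg _) h 2
  rw [mul_pow, EuclideanSpace.norm_sq_eq, EuclideanSpace.norm_sq_eq,
    Matrix.toEuclideanCLM_toLp] at h2
  simpa [opNorm] using h2

theorem opNorm_le_of_sum_sq {n : ℕ} {A : Matrix (Fin n) (Fin n) ℝ} {c : ℝ} (hc : 0 ≤ c)
    (h : ∀ v : Fin n → ℝ, ∑ i, A.mulVec v i ^ 2 ≤ c ^ 2 * ∑ i, v i ^ 2) : opNorm A ≤ c := by
  refine ContinuousLinearMap.opNorm_le_bound _ hc fun x => ?_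
  refine le_of_sq_le_sq ?_ (by positivity) 
  rw [mul_pow, EuclideanSpace.norm_sq_eq, EuclideanSpace.norm_sq_eq]
  simpa using h x.ofLp

theorem exists_unit_eigenvector {n : ℕ} (hn : 0 < n) {A : Matrix (Fin n) (Fin n) ℝ}
    (hA : A.IsSymm) :
    ∃ (u : Fin n → ℝ) (m : ℝ), ∑ i, u i ^ 2 = 1 ∧ A.mulVec u = m • u ∧ |m| = opNorm A := by
  have hH : A.IsHermitian := by
    rw [Matrix.IsHermitian, Matrix.conjTranspose_eq_transpose_of_trivial]; exact hA
  have : Nonempty (Fin n) := ⟨⟨0, hn⟩⟩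
  obtain ⟨j, -, hj⟩ := Finset.exists_max_image Finset.univ (fun i => |hH.eigenvalues i|)
    Finset.univ_nonempty
  have hunit : ∑ i, (hH.eigenvectorBasis j).ofLp i ^ 2 = 1 := by
    have := (hH.eigenvectorBasis.orthonormal.1 j)
    have h2 := EuclideanSpace.norm_sq_eq (hH.eigenvectorBasis j)
    rw [this] at h2
    simpa using h2.symm
  refine ⟨(hH.eigenvectorBasis j).ofLp, hH.eigenvalues j, hunit, hH.mulVec_eigenvectorBasis j, ?_⟩
  refine le_antisymm ?_ ?_
  · have h := sum_sq_mulVec_le A (hH.eigenvectorBasis j).ofLp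
    rw [hH.mulVec_eigenvectorBasis j] at h
    simp only [Pi.smul_apply, smul_eq_mul, mul_pow, ← Finset.mul_sum, hunit, mul_one] at h
    exact abs_le_of_sq_le_sq h (opNorm_nonneg A)
  · refine ContinuousLinearMap.opNorm_le_bound _ (abs_nonneg _) fun x => ?_
    refine le_of_sq_le_sq ?_ (by positivity)
    rw [mul_pow, ← hH.eigenvectorBasis.sum_sq_norm_inner_right,
      ← hH.eigenvectorBasis.sum_sq_norm_inner_right x, Finset.mul_sum]
    refine Finset.sum_le_sum fun i _ => ?_
    have hsym : inner ℝ (hH.eigenvectorBasis i)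
        (Matrix.toEuclideanCLM (n := Fin n) (𝕜 := ℝ) A x) =
        hH.eigenvalues i * inner ℝ (hH.eigenvectorBasis i) x := by
      simp only [PiLp.inner_apply, RCLike.inner_apply, conj_trivial, Matrix.ofLp_toEuclideanCLM]
      change A.mulVec x.ofLp ⬝ᵥ (hH.eigenvectorBasis i).ofLp =
        _ * (x.ofLp ⬝ᵥ (hH.eigenvectorBasis i).ofLp)
      rw [dotProduct_comm, Matrix.dotProduct_mulVec, ← Matrix.mulVec_transpose, hA.eq,
        hH.mulVec_eigenvectorBasis i, smul_dotProduct, dotProduct_comm, smul_eq_mul]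
    rw [hsym, norm_mul, mul_pow]
    gcongr
    exact hj i (Finset.mem_univ i)

theorem IsTopEigenvector.exists_abs_eq_opNorm {n : ℕ} {A : Matrix (Fin n) (Fin n) ℝ}
    (hA : A.IsSymm) {v : Fin n → ℝ} (hv : IsTopEigenvector A v) :
    ∃ m : ℝ, A.mulVec v = m • v ∧ |m| = opNorm A := by
  obtain ⟨h1, m, hm, htop⟩ := hv
  have hn : 0 < n := by
    rcases Nat.eq_zero_or_pos n with rfl | h
    · simp at h1
    · exact h
  obtain ⟨u, l, hu, hl, hle⟩ := exists_unit_eigenvector hn hA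
  refine ⟨m, hm, le_antisymm ?_ ?_⟩
  · have h := sum_sq_mulVec_le A v
    rw [hm] at h
    simp only [Pi.smul_apply, smul_eq_mul, mul_pow, ← Finset.mul_sum, h1, mul_one] at h
    exact abs_le_of_sq_le_sq h (opNorm_nonneg A)
  · rw [← hle]
    refine htop l u ?_ hl
    rintro rfl
    simp at hu

theorem abs_dotProduct_mulVec_le {n : ℕ} (A : Matrix (Fin n) (Fin n) ℝ) {u : Fin n → ℝ}
    (hu : ∑ i, u i ^ 2 = 1) : |u ⬝ᵥ A.mulVec u| ≤ opNorm A := by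
  refine abs_le_of_sq_le_sq ?_ (opNorm_nonneg A)
  have h1 := Finset.sum_mul_sq_le_sq_mul_sq Finset.univ u (A.mulVec u)
  have h2 := sum_sq_mulVec_le A u
  rw [hu] at h1 h2
  simp only [dotProduct]
  linarith

theorem opNorm_le_sum_abs {n : ℕ} (A : Matrix (Fin n) (Fin n) ℝ) :
    opNorm A ≤ ∑ i, ∑ j, |A i j| := by
  refine opNorm_le_of_sum_sq (Finset.sum_nonneg fun i _ => Finset.sum_nonneg fun j _ =>
    abs_nonneg _) fun v => ?_
  have h1 : ∀ i, A.mulVec v i ^ 2 ≤ (∑ j, |A i j|) ^ 2 * ∑ j, v j ^ 2 := fun i => by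
    refine (Finset.sum_mul_sq_le_sq_mul_sq Finset.univ (A i) v).trans ?_
    gcongr
    calc ∑ j, A i j ^ 2 = ∑ j, |A i j| ^ 2 := by simp
      _ ≤ _ := Finset.sum_sq_le_sq_sum_of_nonneg fun j _ => abs_nonneg _
  refine (Finset.sum_le_sum fun i _ => h1 i).trans ?_
  rw [← Finset.sum_mul]
  gcongr
  exact Finset.sum_sq_le_sq_sum_of_nonneg fun i _ => Finset.sum_nonneg fun j _ => abs_nonneg _

theorem continuous_opNorm {n : ℕ} : Continuous (opNorm (n := n)) := by
  have h : Continuous (fun A : Matrix (Fin n) (Fin n) ℝ =>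
      (Matrix.toEuclideanCLM (n := Fin n) (𝕜 := ℝ) A)) :=
    LinearMap.continuous_of_finiteDimensional
      (Matrix.toEuclideanCLM (n := Fin n) (𝕜 := ℝ)).toAlgEquiv.toLinearMap
  exact h.norm

/-! ## Zeroing out -/

theorem zeroOut_empty {n : ℕ} (A : Matrix (Fin n) (Fin n) ℝ) : zeroOut ∅ A = A := by
  ext i j; simp [zeroOut]

theorem zeroOut_singleton_zeroOut {n : ℕ} (i : Fin n) (S : Finset (Fin n))
    (A : Matrix (Fin n) (Fin n) ℝ) : zeroOut {i} (zeroOut S A) = zeroOut (insert i S) A := by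
  ext a b
  simp only [zeroOut, Matrix.of_apply, Finset.mem_singleton, Finset.mem_insert]
  split_ifs <;> tauto

theorem zeroOut_isSymm {n : ℕ} (S : Finset (Fin n)) {A : Matrix (Fin n) (Fin n) ℝ}
    (hA : A.IsSymm) : (zeroOut S A).IsSymm := by
  ext a b
  simp only [zeroOut, Matrix.of_apply, Matrix.transpose_apply, hA.apply, or_comm]

theorem zeroOut_mulVec_of_mem {n : ℕ} {S : Finset (Fin n)} (A : Matrix (Fin n) (Fin n) ℝ)
    (v : Fin n → ℝ) {i : Fin n} (hi : i ∈ S) : (zeroOut S A).mulVec v i = 0 := by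
  simp [Matrix.mulVec, dotProduct, zeroOut, hi]

/-- Outside the corrupted surviving indices, a cleaned corruption of `X` acts like a restriction
of `X`. -/
theorem sum_sq_zeroOut_mulVec_compl_le {n : ℕ} {X Y : Matrix (Fin n) (Fin n) ℝ}
    {Q : Finset (Fin n)} (hQ : SupportedOnMinor Q (Y - X)) (S : Finset (Fin n)) (v : Fin n → ℝ) :
    ∑ i ∈ (Q \ S)ᶜ, (zeroOut S Y).mulVec v i ^ 2 ≤ opNorm X ^ 2 * ∑ i, v i ^ 2 := by
  -- Deleting the entries of `v` in `S` plays the role of the zeroed columns, so uncorrupted rows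
  -- can be compared with `X` itself.
  set v' : Fin n → ℝ := fun i => if i ∈ S then 0 else v i with hv'
  have hX : ∀ i ∈ (Q \ S)ᶜ, (zeroOut S Y).mulVec v i ^ 2 ≤ X.mulVec v' i ^ 2 := fun i hi => by
    by_cases hiS : i ∈ S
    · rw [zeroOut_mulVec_of_mem Y v hiS, zero_pow two_ne_zero]; positivity
    · have hiQ : i ∉ Q := by simp at hi; tauto
      refine le_of_eq (congrArg (· ^ 2) ?_)
      simp only [Matrix.mulVec, dotProduct]
      refine Finset.sum_congr rfl fun j _ => ?_
      have h := hQ i j (fun h => hiQ h.1)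
      rw [Matrix.sub_apply, sub_eq_zero] at h
      by_cases hj : j ∈ S <;> simp [zeroOut, hv', hiS, hj, h]
  calc _ ≤ ∑ i ∈ (Q \ S)ᶜ, X.mulVec v' i ^ 2 := Finset.sum_le_sum hX
    _ ≤ ∑ i, X.mulVec v' i ^ 2 :=
        Finset.sum_le_sum_of_subset_of_nonneg (Finset.subset_univ _) fun i _ _ => sq_nonneg _
    _ ≤ opNorm X ^ 2 * ∑ i, v' i ^ 2 := sum_sq_mulVec_le X v'
    _ ≤ _ := by
        gcongr ?_ * ?_
        refine Finset.sum_le_sum fun i _ => ?_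
        simp only [hv']
        split_ifs
        · rw [zero_pow two_ne_zero]; positivity
        · rfl

/-- The eigenvalue equation turns the bound on the rows of `A v` into one on `v`: the mass is at
most `(‖X‖ / ‖A‖)² ≤ (3/5)²`, which leaves room below `1/2`. -/
theorem sum_sq_topEigenvector_compl_le {n : ℕ} {X Y : Matrix (Fin n) (Fin n) ℝ} (hY : Y.IsSymm)
    {Q S : Finset (Fin n)} (hQ : SupportedOnMinor Q (Y - X)) {M : ℝ} (hM : opNorm X ≤ 3 * M)
    (hS : 5 * M < opNorm (zeroOut S Y)) {v : Fin n → ℝ} (hv : IsTopEigenvector (zeroOut S Y) v) :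
    ∑ i ∈ (Q \ S)ᶜ, v i ^ 2 ≤ 1 / 2 := by
  obtain ⟨m, hm, hmabs⟩ := hv.exists_abs_eq_opNorm (zeroOut_isSymm S hY)
  have h := sum_sq_zeroOut_mulVec_compl_le hQ S v
  rw [hm, hv.1, mul_one] at h
  simp only [Pi.smul_apply, smul_eq_mul, mul_pow, ← Finset.mul_sum] at h
  have h0 := opNorm_nonneg X
  have hm2 : m ^ 2 = opNorm (zeroOut S Y) ^ 2 := by rw [← hmabs, sq_abs]
  rw [hm2] at h
  have hpos : 0 < opNorm (zeroOut S Y) := by linarith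
  have hle : opNorm X ^ 2 ≤ (3 / 5 * opNorm (zeroOut S Y)) ^ 2 :=
    pow_le_pow_left₀ h0 (by linarith) 2
  have hs : ∑ i ∈ (Q \ S)ᶜ, v i ^ 2 ≤ (3 / 5) ^ 2 := by
    rw [mul_pow, mul_comm ((3 / 5 : ℝ) ^ 2)] at hle
    exact le_of_mul_le_mul_left (h.trans hle) (by positivity)
  linarith

theorem half_le_sum_sq_topEigenvector {n : ℕ} {X Y : Matrix (Fin n) (Fin n) ℝ} (hY : Y.IsSymm)
    {Q S : Finset (Fin n)} (hQ : SupportedOnMinor Q (Y - X)) {M : ℝ} (hM : opNorm X ≤ 3 * M)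
    (hS : 5 * M < opNorm (zeroOut S Y)) {v : Fin n → ℝ} (hv : IsTopEigenvector (zeroOut S Y) v) :
    1 / 2 ≤ ∑ i ∈ Q \ S, v i ^ 2 := by
  have h := sum_sq_topEigenvector_compl_le hY hQ hM hS hv
  have h2 := Finset.sum_add_sum_compl (Q \ S) fun i => v i ^ 2
  rw [hv.1] at h2
  linarith

/-! ## Power iteration -/

section PowerIteration

variable {n : ℕ} {A : Matrix (Fin n) (Fin n) ℝ}

/-- The squared norm of the `j`-th iterate of `A` on `g`. -/
def iterSq (A : Matrix (Fin n) (Fin n) ℝ) (g : Fin n → ℝ) (j : ℕ) : ℝ :=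
  ∑ i, (A.mulVec^[j] g) i ^ 2

theorem iterSq_nonneg (A : Matrix (Fin n) (Fin n) ℝ) (g : Fin n → ℝ) (j : ℕ) :
    0 ≤ iterSq A g j := Finset.sum_nonneg fun _ _ => sq_nonneg _

theorem iterSq_succ_le (A : Matrix (Fin n) (Fin n) ℝ) (g : Fin n → ℝ) (j : ℕ) :
    iterSq A g (j + 1) ≤ opNorm A ^ 2 * iterSq A g j := by
  simp only [iterSq, Function.iterate_succ_apply']
  exact sum_sq_mulVec_le A _

/-- Log-convexity: by symmetry `‖A^(j+1) g‖² = ⟨A^j g, A^(j+2) g⟩`, and Cauchy–Schwarz applies. -/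
theorem iterSq_succ_sq_le (hA : A.IsSymm) (g : Fin n → ℝ) (j : ℕ) :
    iterSq A g (j + 1) ^ 2 ≤ iterSq A g j * iterSq A g (j + 2) := by
  have h : iterSq A g (j + 1) = ∑ i, (A.mulVec^[j] g) i * (A.mulVec^[j + 2] g) i := by
    have e1 : iterSq A g (j + 1) = (A.mulVec^[j + 1] g) ⬝ᵥ A.mulVec (A.mulVec^[j] g) := by
      rw [← Function.iterate_succ_apply' A.mulVec]
      simp [iterSq, dotProduct, sq]
    rw [e1, Matrix.dotProduct_mulVec, ← Matrix.mulVec_transpose, hA.eq,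
      ← Function.iterate_succ_apply' A.mulVec, dotProduct_comm]
    rfl
  rw [h]
  exact Finset.sum_mul_sq_le_sq_mul_sq _ _ _

/-- By log-convexity the growth ratios are nondecreasing, so a slow last round forces all earlier
rounds to be slow. -/
theorem iterSq_succ_le_of_le (hA : A.IsSymm) (g : Fin n → ℝ) {c : ℝ} (hc : 0 ≤ c) {j : ℕ}
    (h : iterSq A g (j + 1) ≤ c * iterSq A g j) : iterSq A g (j + 1) ≤ c ^ (j + 1) * iterSq A g 0 := by
  induction j with
  | zero => simpa using h
  | succ j ih =>
    have h1 : iterSq A g (j + 1) ≤ c * iterSq A g j := by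
      rcases (iterSq_nonneg A g (j + 1)).eq_or_lt with h0 | h0
      · rw [← h0]; exact mul_nonneg hc (iterSq_nonneg _ _ _)
      · have h2 := iterSq_succ_sq_le hA g j
        have h3 : iterSq A g j * iterSq A g (j + 2) ≤ iterSq A g j * (c * iterSq A g (j + 1)) :=
          mul_le_mul_of_nonneg_left h (iterSq_nonneg _ _ _)
        refine le_of_mul_le_mul_right ?_ h0
        nlinarith
    calc _ ≤ c * iterSq A g (j + 1) := h
      _ ≤ c * (c ^ (j + 1) * iterSq A g 0) := mul_le_mul_of_nonneg_left (ih h1) hc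
      _ = _ := by ring

/-- The component along the eigenvector `u` is multiplied by exactly `m` in each round. -/
theorem pow_mul_dotProduct_sq_le_iterSq (hA : A.IsSymm) {u : Fin n → ℝ} {m : ℝ}
    (hu : ∑ i, u i ^ 2 = 1) (hm : A.mulVec u = m • u) (g : Fin n → ℝ) (j : ℕ) :
    (m ^ 2) ^ j * (u ⬝ᵥ g) ^ 2 ≤ iterSq A g j := by
  have h : u ⬝ᵥ (A.mulVec^[j] g) = m ^ j * (u ⬝ᵥ g) := by
    induction j with
    | zero => simp
    | succ j ih =>
      rw [Function.iterate_succ_apply', Matrix.dotProduct_mulVec, ← Matrix.mulVec_transpose, hA.eq,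
        hm, smul_dotProduct, ih, smul_eq_mul]
      ring
  have h2 := Finset.sum_mul_sq_le_sq_mul_sq Finset.univ u (A.mulVec^[j] g)
  rw [hu, one_mul] at h2
  calc _ = (u ⬝ᵥ (A.mulVec^[j] g)) ^ 2 := by rw [h]; ring
    _ ≤ _ := h2

/-- After logarithmically many rounds, power iteration grows at nearly the full rate. -/
theorem mul_iterSq_le_iterSq_succ (hn : 2 ≤ n) (hA : A.IsSymm) {u : Fin n → ℝ} {m : ℝ}
    (hu : ∑ i, u i ^ 2 = 1) (hm : A.mulVec u = m • u) {g : Fin n → ℝ}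
    (hg : ∑ i, g i ^ 2 ≤ (n : ℝ) ^ 5) (hug : 1 / (4 * (n : ℝ)) ≤ (u ⬝ᵥ g) ^ 2) {j : ℕ}
    (hj : 100 * Nat.clog 2 n ≤ j) :
    81 / 100 * m ^ 2 * iterSq A g j ≤ iterSq A g (j + 1) := by
  -- A slow last round would give `iterSq A g (j + 1) ≤ (0.81 m²) ^ (j + 1) n ^ 5`, while the
  -- component along `u` alone contributes at least `m ^ (2 (j + 1)) / (4 n)`.
  by_contra! hcon
  have hn' : (2 : ℝ) ≤ n := by exact_mod_cast hn
  have h1 := iterSq_succ_le_of_le hA g (by positivity) hcon.le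
  have h2 := pow_mul_dotProduct_sq_le_iterSq hA hu hm g (j + 1)
  have hm0 : 0 < m ^ 2 := by
    rcases (sq_nonneg m).eq_or_lt with h | h
    · rw [← h] at hcon
      have := iterSq_nonneg A g (j + 1)
      simp at hcon
      linarith
    · exact h
  have h0 : iterSq A g 0 ≤ (n : ℝ) ^ 5 := hg
  have h3 : (m ^ 2) ^ (j + 1) * (1 / (4 * (n : ℝ))) ≤
      (m ^ 2) ^ (j + 1) * ((81 / 100) ^ (j + 1) * (n : ℝ) ^ 5) :=
    calc _ ≤ (m ^ 2) ^ (j + 1) * (u ⬝ᵥ g) ^ 2 := by gcongr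
      _ ≤ _ := h2
      _ ≤ _ := h1
      _ ≤ (81 / 100 * m ^ 2) ^ (j + 1) * (n : ℝ) ^ 5 := by gcongr
      _ = _ := by rw [mul_pow]; ring
  have h4 : 1 / (4 * (n : ℝ)) ≤ (81 / 100) ^ (j + 1) * (n : ℝ) ^ 5 :=
    le_of_mul_le_mul_left h3 (by positivity)
  -- Since `0.81 ^ 100 ≤ 2 ^ (-8)`, these rounds gain a factor `n ^ 8`, more than the `4 n ^ 6`
  -- separating the two bounds.
  have h5 : ((81 : ℝ) / 100) ^ (j + 1) ≤ 81 / 100 * ((n : ℝ) ^ 8)⁻¹ := by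
    have hclog : (n : ℝ) ≤ 2 ^ Nat.clog 2 n := by exact_mod_cast Nat.le_pow_clog one_lt_two n
    calc ((81 : ℝ) / 100) ^ (j + 1) = 81 / 100 * (81 / 100) ^ j := by ring
      _ ≤ 81 / 100 * (81 / 100) ^ (100 * Nat.clog 2 n) := by
          gcongr ?_ * ?_
          exact pow_le_pow_of_le_one (by norm_num) (by norm_num) hj
      _ = 81 / 100 * ((81 / 100) ^ 100) ^ Nat.clog 2 n := by rw [pow_mul]
      _ ≤ 81 / 100 * ((1 / 2) ^ 8) ^ Nat.clog 2 n := by gcongr; norm_num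
      _ = 81 / 100 * ((2 ^ Nat.clog 2 n) ^ 8)⁻¹ := by
          rw [← pow_mul, mul_comm 8, pow_mul]; simp
      _ ≤ _ := by gcongr
  have h6 : 1 / (4 * (n : ℝ)) ≤ 81 / 100 * ((n : ℝ) ^ 8)⁻¹ * (n : ℝ) ^ 5 :=
    h4.trans (by gcongr)
  have h7 : 81 / 100 * ((n : ℝ) ^ 8)⁻¹ * (n : ℝ) ^ 5 = 81 / 100 / (n : ℝ) ^ 3 := by
    field_simp
  rw [h7, div_le_div_iff₀ (by positivity) (by positivity)] at h6
  nlinarith [mul_le_mul hn' hn' (by norm_num) (by linarith)]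

end PowerIteration

/-! ## The random start -/

theorem sum_sq_le_of_mem_support_startLaw {n : ℕ} {g : Fin n → ℝ}
    (hg : g ∈ (startLaw n).support) : ∑ i, g i ^ 2 ≤ (n : ℝ) ^ 5 := by
  rw [startLaw, PMF.mem_support_map_iff] at hg
  obtain ⟨a, -, rfl⟩ := hg
  calc ∑ i, (((a i : ℕ) : ℝ)) ^ 2 ≤ ∑ _i : Fin n, ((n : ℝ) ^ 2) ^ 2 := by
        refine Finset.sum_le_sum fun i _ => ?_
        gcongr
        exact_mod_cast Nat.lt_succ_iff.mp (a i).2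
    _ = _ := by simp; ring

/-- Some `u i ^ 2` is at least `1 / n`. With the other coordinates fixed, changing the integer `g i`
moves `u ⬝ᵥ g` by at least `1 / √n`, whereas two bad values differ by less. So each line in
direction `i` contains at most one bad start. -/
theorem startLaw_dotProduct_sq_lt {n : ℕ} {u : Fin n → ℝ} (hu : ∑ i, u i ^ 2 = 1) :
    (startLaw n).toOuterMeasure {g | (u ⬝ᵥ g) ^ 2 < 1 / (4 * (n : ℝ))} ≤
      ((n : ℝ≥0∞) ^ 2 + 1)⁻¹ := by
  classical
  have hn : 0 < n := by
    rcases Nat.eq_zero_or_pos n with rfl | h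
    · simp at hu
    · exact h
  have hn' : (0 : ℝ) < n := by exact_mod_cast hn
  obtain ⟨i, hi⟩ : ∃ i, 1 / (n : ℝ) ≤ u i ^ 2 := by
    by_contra! h
    have : ∑ i, u i ^ 2 < ∑ _i : Fin n, 1 / (n : ℝ) :=
      Finset.sum_lt_sum_of_nonempty ⟨⟨0, hn⟩, Finset.mem_univ _⟩ fun i _ => h i
    rw [hu] at this
    simp [hn.ne'] at this
  rw [startLaw, PMF.toOuterMeasure_map_apply, PMF.toOuterMeasure_uniformOfFintype_apply]
  set B : Set (Fin n → Fin (n ^ 2 + 1)) :=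
    (fun g i => ((g i : ℕ) : ℝ)) ⁻¹' {g | (u ⬝ᵥ g) ^ 2 < 1 / (4 * (n : ℝ))} with hB
  -- Overwriting coordinate `i` of a bad start by an arbitrary value loses no information, so the
  -- bad starts number at most a fraction `1 / (n ^ 2 + 1)` of all starts.
  have hinj : Function.Injective fun p : B × Fin (n ^ 2 + 1) => Function.update p.1.1 i p.2 := by
    rintro ⟨⟨g, hg⟩, a⟩ ⟨⟨g', hg'⟩, a'⟩ h
    dsimp only at h
    have ha : a = a' := by simpa using congrFun h i
    have hoff : ∀ j, j ≠ i → g j = g' j := fun j hj => by simpa [hj] using congrFun h j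
    have hgi : g i = g' i := by
      simp only [hB, Set.mem_preimage, Set.mem_ofPred_eq] at hg hg'
      have e : u ⬝ᵥ (fun i => ((g i : ℕ) : ℝ)) - u ⬝ᵥ (fun i => ((g' i : ℕ) : ℝ)) =
          u i * ((g i : ℕ) - (g' i : ℕ)) := by
        simp only [dotProduct]
        rw [← Finset.sum_sub_distrib, Finset.sum_eq_single i]
        · ring
        · intro j _ hj
          rw [hoff j hj]; ring
        · simp
      have h1 : (u i * (((g i : ℕ) : ℝ) - (g' i : ℕ))) ^ 2 < 1 / n := by
        rw [← e]
        have h3 : (4 : ℝ) * (1 / (4 * n)) = 1 / n := by field_simp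
        nlinarith [sq_nonneg (u ⬝ᵥ (fun i => ((g i : ℕ) : ℝ)) + u ⬝ᵥ (fun i => ((g' i : ℕ) : ℝ)))]
      by_contra hne
      have hne' : ((g i : ℕ) : ℤ) - (g' i : ℕ) ≠ 0 := by
        intro h0
        exact hne (Fin.ext (by omega))
      have h2 : (1 : ℝ) ≤ (((g i : ℕ) : ℝ) - (g' i : ℕ)) ^ 2 := by
        have : (1 : ℤ) ≤ (((g i : ℕ) : ℤ) - (g' i : ℕ)) ^ 2 := by
          have := sq_pos_of_ne_zero hne'
          omega
        exact_mod_cast this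
      rw [mul_pow] at h1
      have := mul_le_mul hi h2 (by norm_num) (by positivity)
      linarith
    have hgg : g = g' := by
      ext j
      by_cases hj : j = i
      · rw [hj, hgi]
      · rw [hoff j hj]
    subst hgg ha
    rfl
  have hcard := Fintype.card_le_of_injective _ hinj
  rw [Fintype.card_prod, Fintype.card_fin] at hcard
  have hpos : 0 < Fintype.card (Fin n → Fin (n ^ 2 + 1)) := Fintype.card_pos
  rw [ENNReal.div_le_iff (by exact_mod_cast hpos.ne') (by simp), mul_comm, ← div_eq_mul_inv,
    ENNReal.le_div_iff_mul_le (by simp) (by simp)]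
  exact_mod_cast hcard

/-! ## The cleaning loop -/

theorem toOuterMeasure_le_one {α : Type*} (p : PMF α) (s : Set α) : p.toOuterMeasure s ≤ 1 := by
  rw [PMF.toOuterMeasure_apply, ← p.tsum_coe]
  exact ENNReal.tsum_le_tsum fun a => Set.indicator_le_self _ _ _

theorem toOuterMeasure_add_compl {α : Type*} (p : PMF α) (s : Set α) :
    p.toOuterMeasure s + p.toOuterMeasure sᶜ = 1 := by
  rw [PMF.toOuterMeasure_apply, PMF.toOuterMeasure_apply, ← ENNReal.tsum_add, ← p.tsum_coe]
  exact tsum_congr fun a => Set.indicator_self_add_compl_apply s p a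

theorem toOuterMeasure_bind_le {α β : Type*} (p : PMF α) (f : α → PMF β) (s : Set β) (B : Set α)
    (c : ℝ≥0∞) (h : ∀ a ∈ p.support, a ∉ B → (f a).toOuterMeasure s ≤ c) :
    (p.bind f).toOuterMeasure s ≤ p.toOuterMeasure B + c := by
  rw [PMF.toOuterMeasure_bind_apply, PMF.toOuterMeasure_apply]
  have hc : c = ∑' a, p a * c := by rw [ENNReal.tsum_mul_right, p.tsum_coe, one_mul]
  rw [hc, ← ENNReal.tsum_add]
  refine ENNReal.tsum_le_tsum fun a => ?_
  by_cases ha : a ∈ B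
  · rw [Set.indicator_of_mem ha]
    calc _ ≤ p a * 1 := by gcongr; exact toOuterMeasure_le_one _ _
      _ ≤ _ := by rw [mul_one]; exact le_self_add
  · by_cases hp : a ∈ p.support
    · calc _ ≤ p a * c := by gcongr; exact h a hp ha
        _ ≤ _ := le_add_self
    · rw [(p.apply_eq_zero_iff a).mpr hp]; simp

/-- The outcomes of a cleaning loop within budget: at most `t` removals beyond `S`, at most `b`
steps, and a final operator norm at most `C`. -/
def goodOutcome {n : ℕ} (Y : Matrix (Fin n) (Fin n) ℝ) (C : ℝ) (t b : ℕ) :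
    Set (Option (Matrix (Fin n) (Fin n) ℝ) × ℕ) :=
  {r | r.2 ≤ b ∧ ∃ S : Finset (Fin n), S.card ≤ t ∧ r.1 = some (zeroOut S Y) ∧
    opNorm (zeroOut S Y) ≤ C}

/-- Here `t` is the number of removals still allowed and `η` the price of a wrong stop at one test.
The potential `2 ^ |Q \ S|` halves when a surviving index of `Q` is removed and is unchanged
otherwise; as the latter has probability at most `1/2`, each removal gains `1/2 + 1/2 * 1/2 = 3/4`.
By `hnew` every removal enlarges `S`, so `hT` keeps the tests from running out. -/
theorem cleanLoop_compl_goodOutcome_le {n : ℕ} {Y : Matrix (Fin n) (Fin n) ℝ}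
    {Q : Finset (Fin n)} {C : ℝ} {η : ℝ≥0∞} {c₁ c : ℕ}
    {test : Matrix (Fin n) (Fin n) ℝ → Rand (Option (Fin n))}
    (hcost : ∀ S, ∀ r ∈ (test (zeroOut S Y)).support, r.2 ≤ c₁)
    (hnew : ∀ S, ∀ r ∈ (test (zeroOut S Y)).support, ∀ i, r.1 = some i → i ∉ S)
    (hnone_le : ∀ S, C < opNorm (zeroOut S Y) →
      (test (zeroOut S Y)).toOuterMeasure {r | r.1 = none} ≤ η)
    (hout : ∀ S, (test (zeroOut S Y)).toOuterMeasure {r | ∃ i, r.1 = some i ∧ i ∉ Q} ≤ 2⁻¹)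
    (T t : ℕ) (S : Finset (Fin n)) (hT : n < T + S.card) :
    (cleanLoop test c T (zeroOut S Y)).toOuterMeasure
        (goodOutcome Y C (S.card + t) ((t + 1) * c₁ + t * c))ᶜ ≤
      2 ^ (Q \ S).card * (3 / 4) ^ t + T * η := by
  induction T generalizing t S with
  | zero => exact absurd hT (by simpa using S.card_le_univ)
  | succ T ih =>
    rcases t with _ | t
    -- With no removals left the potential is at least `1` and the bound is trivial.
    · refine (toOuterMeasure_le_one _ _).trans (le_add_right ?_)
      rw [pow_zero, mul_one]
      exact one_le_pow₀ one_le_two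
    set p := test (zeroOut S Y) with hp
    set u : ℝ≥0∞ := 2 ^ (Q \ S).card * (3 / 4) ^ t with hu
    have hu2 : 2 ^ (Q \ S).card * (3 / 4) ^ (t + 1) = u * 2⁻¹ + 2⁻¹ * (u * 2⁻¹) := by
      have : (3 / 4 : ℝ≥0∞) = 2⁻¹ + 2⁻¹ * 2⁻¹ := by
        rw [← ENNReal.toReal_eq_toReal_iff' (by finiteness) (by finiteness),
          ENNReal.toReal_add (by finiteness) (by finiteness)]
        simp; norm_num
      rw [pow_succ, ← mul_assoc, ← hu, this]
      ring
    -- Outcome by outcome: a wrong stop is charged `1`, every outcome is charged `u / 2` and the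
    -- later wrong stops, and an index outside `Q` is charged a second `u / 2`.
    have key : ∀ r ∈ p.support,
        ((match r.1 with
          | none => (Rand.ret (some (zeroOut S Y)) : Rand (Option (Matrix (Fin n) (Fin n) ℝ)))
          | some i => Rand.bind (Rand.lift ⟨zeroOut {i} (zeroOut S Y), c⟩)
              (cleanLoop test c T)).map fun b : Option (Matrix (Fin n) (Fin n) ℝ) × ℕ =>
          (b.1, r.2 + b.2)).toOuterMeasure
            (goodOutcome Y C (S.card + (t + 1)) ((t + 1 + 1) * c₁ + (t + 1) * c))ᶜ ≤
          {r | C < opNorm (zeroOut S Y) ∧ r.1 = none}.indicator 1 r +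
          {r : Option (Fin n) × ℕ | ∃ i, r.1 = some i ∧ i ∉ Q}.indicator 1 r * (u * 2⁻¹) +
          (u * 2⁻¹ + T * η) := by
      rintro ⟨o, m⟩ hr
      have hm : m ≤ c₁ := hcost S _ hr
      rcases o with _ | i
      · by_cases hC : C < opNorm (zeroOut S Y)
        · refine (toOuterMeasure_le_one _ _).trans ?_
          rw [Set.indicator_of_mem (by exact ⟨hC, rfl⟩), add_assoc]
          exact le_self_add
        · simp only [Rand.ret, PMF.pure_map, PMF.toOuterMeasure_pure_apply]
          rw [if_neg]
          · exact zero_le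
          · rw [Set.notMem_compl_iff]
            refine ⟨?_, S, by omega, rfl, not_lt.mp hC⟩
            dsimp only
            nlinarith
      · have hiS : i ∉ S := hnew S _ hr i rfl
        have hcard : (insert i S).card = S.card + 1 := Finset.card_insert_of_notMem hiS
        have h1 := ih t (insert i S) (by omega)
        have h2 : ((Rand.bind (Rand.lift ⟨zeroOut {i} (zeroOut S Y), c⟩)
            (cleanLoop test c T)).map fun b : Option (Matrix (Fin n) (Fin n) ℝ) × ℕ =>
            (b.1, m + b.2)).toOuterMeasure
            (goodOutcome Y C (S.card + (t + 1)) ((t + 1 + 1) * c₁ + (t + 1) * c))ᶜ ≤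
            (cleanLoop test c T (zeroOut (insert i S) Y)).toOuterMeasure
            (goodOutcome Y C ((insert i S).card + t) ((t + 1) * c₁ + t * c))ᶜ := by
          simp only [Rand.bind, Rand.lift, PMF.pure_bind, PMF.map_comp, zeroOut_singleton_zeroOut,
            PMF.toOuterMeasure_map_apply]
          refine OuterMeasure.mono _ ?_
          rw [Set.preimage_compl, Set.compl_subset_compl]
          rintro ⟨B, s⟩ ⟨hs, S', hS', hB, hBC⟩
          refine ⟨?_, S', by omega, hB, hBC⟩
          dsimp only [Function.comp] at hs ⊢
          nlinarith
        refine h2.trans (h1.trans ?_)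
        by_cases hiQ : i ∈ Q
        · have hq : (Q \ S).card = (Q \ insert i S).card + 1 := by
            rw [← Finset.card_insert_of_notMem (s := Q \ insert i S) (a := i) (by simp)]
            congr 1
            ext j
            simp only [Finset.mem_sdiff, Finset.mem_insert]
            by_cases hj : j = i
            · subst hj; simp [hiQ, hiS]
            · simp [hj]
          refine le_trans (le_of_eq ?_) le_add_self
          rw [hu, hq, pow_succ]
          congr 1
          rw [mul_right_comm, mul_assoc _ (2 : ℝ≥0∞), ENNReal.mul_inv_cancel (by simp) (by simp), mul_one]
        · have hq : Q \ insert i S = Q \ S := by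
            ext j
            simp only [Finset.mem_sdiff, Finset.mem_insert]
            by_cases hj : j = i
            · subst hj; simp [hiQ]
            · simp [hj]
          have hi : (some i, m) ∈ {r : Option (Fin n) × ℕ | ∃ i, r.1 = some i ∧ i ∉ Q} :=
            ⟨i, rfl, hiQ⟩
          rw [hq, ← hu, Set.indicator_of_mem hi, Pi.one_apply, one_mul]
          calc u + T * η = u * 2⁻¹ + (u * 2⁻¹ + T * η) := by
                rw [← add_assoc, ← mul_add, ENNReal.inv_two_add_inv_two, mul_one]
            _ ≤ _ := by gcongr; exact le_add_self
    have hnone : p.toOuterMeasure {r | C < opNorm (zeroOut S Y) ∧ r.1 = none} ≤ η := by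
      by_cases hC : C < opNorm (zeroOut S Y)
      · simpa [hC] using hnone_le S hC
      · simp [hC]
    have hind : ∀ s : Set (Option (Fin n) × ℕ),
        ∑' r, p r * s.indicator 1 r = p.toOuterMeasure s := fun s => by
      rw [PMF.toOuterMeasure_apply]
      exact tsum_congr fun r => by by_cases h : r ∈ s <;> simp [h]
    calc (cleanLoop test c (T + 1) (zeroOut S Y)).toOuterMeasure _
        ≤ ∑' r, p r * ({r | C < opNorm (zeroOut S Y) ∧ r.1 = none}.indicator 1 r +
          {r : Option (Fin n) × ℕ | ∃ i, r.1 = some i ∧ i ∉ Q}.indicator 1 r * (u * 2⁻¹) +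
          (u * 2⁻¹ + T * η)) := by
          rw [cleanLoop, Rand.bind, PMF.toOuterMeasure_bind_apply]
          refine ENNReal.tsum_le_tsum fun r => ?_
          by_cases hr : r ∈ p.support
          · exact mul_le_mul_right (key r hr) _
          · rw [← hp, (p.apply_eq_zero_iff r).mpr hr, zero_mul, zero_mul]
      _ = p.toOuterMeasure {r | C < opNorm (zeroOut S Y) ∧ r.1 = none} +
          p.toOuterMeasure {r : Option (Fin n) × ℕ | ∃ i, r.1 = some i ∧ i ∉ Q} * (u * 2⁻¹) +
          (u * 2⁻¹ + T * η) := by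
          simp_rw [mul_add, ← mul_assoc]
          rw [ENNReal.tsum_add, ENNReal.tsum_add, ENNReal.tsum_add]
          simp_rw [ENNReal.tsum_mul_right, hind, p.tsum_coe, one_mul]
      _ ≤ η + 2⁻¹ * (u * 2⁻¹) + (u * 2⁻¹ + T * η) := by
          gcongr
          exact hout S
      _ = _ := by rw [hu2]; push_cast; ring

/-! ## Subgaussian variables -/

/-- Applied to `t * Z`, the linear term integrates to zero and only the exponential of a square
remains. -/
theorem exp_le_add_exp_sq (x : ℝ) : Real.exp x ≤ x + Real.exp (x ^ 2) := by
  have h := Real.add_one_le_exp (x ^ 2)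
  rcases le_total |x| 1 with h1 | h1
  · have := (abs_le.mp (Real.abs_exp_sub_one_sub_id_le h1)).2
    linarith
  · rcases le_abs'.mp h1 with h2 | h2
    · have : Real.exp x ≤ 1 := Real.exp_le_one_iff.mpr (by linarith)
      nlinarith
    · have : Real.exp x ≤ Real.exp (x ^ 2) := Real.exp_le_exp.mpr (by nlinarith)
      linarith

section Subgaussian

variable {Ω : Type*} [MeasurableSpace Ω] {P : Measure Ω} {Z : Ω → ℝ} {s : ℝ}

theorem IsSubgaussian.integral_even_le (hs : IsSubgaussian P Z s) (k : ℕ) :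
    Integrable (fun ω => Z ω ^ (2 * k)) P ∧
      ∫ ω, Z ω ^ (2 * k) ∂P ≤ (s ^ 2) ^ k * (2 * k) ^ k := by
  obtain ⟨h1, h2⟩ := hs.2 (2 * k)
  have e : (fun ω => |Z ω| ^ (2 * k)) = fun ω => Z ω ^ (2 * k) := by
    ext ω; rw [pow_mul, sq_abs, pow_mul]
  rw [e] at h1
  simp only [e] at h2
  refine ⟨h1, h2.trans (le_of_eq ?_)⟩
  rw [pow_mul]
  push_cast
  rw [mul_div_cancel_left₀ _ (two_ne_zero), Real.rpow_natCast]

/-- Integrate the exponential series termwise. By `k ^ k / k! ≤ e ^ k` the terms are dominated by a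
geometric series of ratio `x ≤ 1/2`, and `1 / (1 - x) ≤ 1 + 2 x ≤ exp (2 x)`. -/
theorem IsSubgaussian.integral_exp_sq_le [IsProbabilityMeasure P] (hs : IsSubgaussian P Z s) {l : ℝ}
    (hl : 0 ≤ l) (hl2 : 4 * Real.exp 1 * (l * s ^ 2) ≤ 1) :
    Integrable (fun ω => Real.exp (l * Z ω ^ 2)) P ∧
      ∫ ω, Real.exp (l * Z ω ^ 2) ∂P ≤ Real.exp (4 * Real.exp 1 * (l * s ^ 2)) := by
  set x : ℝ := 2 * Real.exp 1 * (l * s ^ 2) with hx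
  have hx0 : 0 ≤ x := by positivity
  have hx1 : x ≤ 1 / 2 := by rw [hx]; linarith
  set F : ℕ → Ω → ℝ := fun k ω => (l * Z ω ^ 2) ^ k / k.factorial with hF
  have hF0 : ∀ k ω, 0 ≤ F k ω := fun k ω => by positivity
  have hFint : ∀ k, Integrable (F k) P := fun k => by
    have := ((hs.integral_even_le k).1.const_mul (l ^ k)).div_const (k.factorial : ℝ)
    refine this.congr (Filter.Eventually.of_forall fun ω => ?_)
    simp only [hF]
    rw [mul_pow, pow_mul]
  have hFle : ∀ k, ∫ ω, F k ω ∂P ≤ x ^ k := fun k => by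
    have e : ∀ ω, F k ω = l ^ k / k.factorial * Z ω ^ (2 * k) := fun ω => by
      simp only [hF]; rw [mul_pow, pow_mul]; ring
    simp only [e]
    rw [integral_const_mul]
    calc _ ≤ l ^ k / k.factorial * ((s ^ 2) ^ k * (2 * k) ^ k) := by
          gcongr; exact (hs.integral_even_le k).2
      _ = (2 * l * s ^ 2) ^ k * ((k : ℝ) ^ k / k.factorial) := by
          simp only [mul_pow]; ring
      _ ≤ (2 * l * s ^ 2) ^ k * Real.exp k := by
          gcongr
          exact Real.pow_div_factorial_le_exp _ (by positivity) _
      _ = x ^ k := by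
          rw [hx, ← Real.exp_one_pow k, ← mul_pow]; ring_nf
  have hsum : Summable fun k => ∫ ω, ‖F k ω‖ ∂P := by
    refine Summable.of_nonneg_of_le (fun k => integral_nonneg fun ω => norm_nonneg _)
      (fun k => ?_) (summable_geometric_of_lt_one hx0 (by linarith))
    simpa only [Real.norm_of_nonneg (hF0 k _)] using hFle k
  have hexp : ∀ ω, HasSum (fun k => F k ω) (Real.exp (l * Z ω ^ 2)) := fun ω => by
    rw [Real.exp_eq_exp_ℝ]
    exact NormedSpace.expSeries_div_hasSum_exp (l * Z ω ^ 2)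
  have htsum : (fun ω => Real.exp (l * Z ω ^ 2)) = fun ω => ∑' k, F k ω := by
    ext ω; exact (hexp ω).tsum_eq.symm
  have hHS := hasSum_integral_of_summable_integral_norm hFint hsum
  have hle : ∫ ω, Real.exp (l * Z ω ^ 2) ∂P ≤ (1 - x)⁻¹ := by
    rw [htsum]
    exact hasSum_le hFle hHS (hasSum_geometric_of_lt_one hx0 (by linarith))
  refine ⟨?_, hle.trans ?_⟩
  -- A non-integrable function has Bochner integral `0`, so the lower bound `1` from the zeroth term
  -- of the series proves integrability.
  · refine Integrable.of_integral_ne_zero (ne_of_gt (lt_of_lt_of_le one_pos ?_))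
    rw [htsum]
    refine le_trans (le_of_eq ?_) (le_hasSum hHS 0 fun k _ => integral_nonneg (hF0 k))
    simp [hF]
  · rw [inv_le_comm₀ (by linarith) (Real.exp_pos _), ← Real.exp_neg]
    have h1 : Real.exp (-(4 * Real.exp 1 * (l * s ^ 2))) = (Real.exp (2 * x))⁻¹ := by
      rw [← Real.exp_neg, hx]; ring_nf
    rw [h1, inv_le_comm₀ (Real.exp_pos _) (by linarith)]
    calc (1 - x)⁻¹ ≤ 2 * x + 1 := by
          rw [inv_le_iff_one_le_mul₀ (by linarith)]; nlinarith
      _ ≤ _ := Real.add_one_le_exp _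

/-- Moment-subgaussian variables have a subgaussian moment generating function. -/
theorem IsSubgaussian.hasSubgaussianMGF [IsProbabilityMeasure P] (hm : Measurable Z)
    (hs : IsSubgaussian P Z s) :
    HasSubgaussianMGF Z (Real.toNNReal (10 * Real.exp 1 * s ^ 2)) P := by
  have he : 0 < Real.exp 1 := Real.exp_pos 1
  have hZ : Integrable Z P := by
    have := (hs.2 1).1
    simp only [pow_one] at this
    exact (integrable_norm_iff hm.aestronglyMeasurable).mp this
  have key : ∀ t : ℝ, Integrable (fun ω => Real.exp (t * Z ω)) P ∧
      ∫ ω, Real.exp (t * Z ω) ∂P ≤ Real.exp (5 * Real.exp 1 * s ^ 2 * t ^ 2) := fun t => by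
    have hmeas : AEStronglyMeasurable (fun ω => Real.exp (t * Z ω)) P :=
      (hm.const_mul t).exp.aestronglyMeasurable
    rcases le_total (4 * Real.exp 1 * (t ^ 2 * s ^ 2)) 1 with h | h
    · obtain ⟨h1, h2⟩ := hs.integral_exp_sq_le (sq_nonneg t) h
      have hb : ∀ ω, Real.exp (t * Z ω) ≤ t * Z ω + Real.exp (t ^ 2 * Z ω ^ 2) := fun ω => by
        rw [← mul_pow]; exact exp_le_add_exp_sq _
      have hi := (hZ.const_mul t).add h1
      have hint : Integrable (fun ω => Real.exp (t * Z ω)) P :=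
        hi.mono' hmeas (Filter.Eventually.of_forall fun ω => by
          rw [Real.norm_of_nonneg (Real.exp_pos _).le]; exact hb ω)
      refine ⟨hint, (integral_mono hint hi hb).trans ?_⟩
      simp only [Pi.add_apply]
      rw [integral_add (hZ.const_mul t) h1, integral_const_mul, hs.1, mul_zero, zero_add]
      refine h2.trans (Real.exp_le_exp.mpr ?_)
      nlinarith [show 0 ≤ Real.exp 1 * (s ^ 2 * t ^ 2) by positivity]
    -- For large `t` the mean is irrelevant: completing the square splits `t Z` into `e s² t²` and
    -- `l Z²`, with `l` the largest value allowed above. The resulting additive `1` is absorbed by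
    -- `4 e s² t² ≥ 1`.
    · have hs0 : 0 < s ^ 2 := by
        rcases (sq_nonneg s).eq_or_lt with h0 | h0
        · rw [← h0] at h; norm_num at h
        · exact h0
      have hs1 : s ≠ 0 := fun h0 => by simp [h0] at hs0
      set l : ℝ := 1 / (4 * Real.exp 1 * s ^ 2) with hl
      have hls : 4 * Real.exp 1 * (l * s ^ 2) = 1 := by rw [hl]; field_simp
      obtain ⟨h1, h2⟩ := hs.integral_exp_sq_le (show 0 ≤ l by positivity) hls.le
      have hb : ∀ ω, Real.exp (t * Z ω) ≤
          Real.exp (Real.exp 1 * s ^ 2 * t ^ 2) * Real.exp (l * Z ω ^ 2) := fun ω => by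
        rw [← Real.exp_add]
        refine Real.exp_le_exp.mpr ?_
        have e : Real.exp 1 * s ^ 2 * t ^ 2 + l * Z ω ^ 2 - t * Z ω =
            (2 * Real.exp 1 * s ^ 2 * t - Z ω) ^ 2 / (4 * Real.exp 1 * s ^ 2) := by
          rw [hl]; field_simp; ring
        have : 0 ≤ (2 * Real.exp 1 * s ^ 2 * t - Z ω) ^ 2 / (4 * Real.exp 1 * s ^ 2) := by
          positivity
        linarith
      have hi := h1.const_mul (Real.exp (Real.exp 1 * s ^ 2 * t ^ 2))
      have hint : Integrable (fun ω => Real.exp (t * Z ω)) P :=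
        hi.mono' hmeas (Filter.Eventually.of_forall fun ω => by
          rw [Real.norm_of_nonneg (Real.exp_pos _).le]; exact hb ω)
      refine ⟨hint, (integral_mono hint hi hb).trans ?_⟩
      rw [integral_const_mul]
      calc _ ≤ Real.exp (Real.exp 1 * s ^ 2 * t ^ 2) *
            Real.exp (4 * Real.exp 1 * (l * s ^ 2)) := by gcongr
        _ = Real.exp (Real.exp 1 * s ^ 2 * t ^ 2 + 1) := by rw [← Real.exp_add, hls]
        _ ≤ _ := Real.exp_le_exp.mpr (by nlinarith)
  refine ⟨fun t => (key t).1, fun t => (key t).2.trans (le_of_eq ?_)⟩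
  rw [Real.coe_toNNReal _ (by positivity)]
  ring_nf

end Subgaussian

/-! ## A net for the operator norm -/

/-- A `1/2`-separated set of maximal size is a net. Scaled by `2` it is `1`-separated in the ball of
radius `2`, which bounds its size. -/
theorem exists_net (n : ℕ) : ∃ N : Finset (EuclideanSpace ℝ (Fin n)), N.card ≤ 5 ^ n ∧
    (∀ x ∈ N, ‖x‖ ≤ 1) ∧ ∀ u : EuclideanSpace ℝ (Fin n), ‖u‖ ≤ 1 → ∃ x ∈ N, ‖u - x‖ ≤ 1 / 2 := by
  classical
  let good : Finset (EuclideanSpace ℝ (Fin n)) → Prop := fun N =>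
    (∀ x ∈ N, ‖x‖ ≤ 1) ∧ ∀ x ∈ N, ∀ y ∈ N, x ≠ y → 1 / 2 < ‖x - y‖
  have hcard : ∀ N, good N → N.card ≤ 5 ^ n := fun N hN => by
    have hinj : Function.Injective fun x : EuclideanSpace ℝ (Fin n) => (2 : ℝ) • x :=
      smul_right_injective _ two_ne_zero
    have h := Besicovitch.card_le_of_separated (N.image fun x => (2 : ℝ) • x) ?_ ?_
    · rwa [Finset.card_image_of_injective _ hinj, finrank_euclideanSpace_fin] at h
    · intro c hc
      obtain ⟨x, hx, rfl⟩ := Finset.mem_image.mp hc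
      rw [norm_smul, Real.norm_of_nonneg zero_le_two]
      linarith [hN.1 x hx]
    · intro c hc d hd hcd
      obtain ⟨x, hx, rfl⟩ := Finset.mem_image.mp hc
      obtain ⟨y, hy, rfl⟩ := Finset.mem_image.mp hd
      rw [← smul_sub, norm_smul, Real.norm_of_nonneg zero_le_two]
      linarith [hN.2 x hx y hy fun h => hcd (by rw [h])]
  -- The least deficit `k` from `5 ^ n` corresponds to the largest separated set.
  have hex : ∃ k, ∃ N, good N ∧ N.card = 5 ^ n - k := by
    refine ⟨5 ^ n, ∅, ⟨by simp, by simp⟩, by simp⟩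
  obtain ⟨N, hN, hNk⟩ := Nat.find_spec hex
  refine ⟨N, hcard N hN, hN.1, fun u hu => ?_⟩
  by_contra! hfar
  have huN : u ∉ N := fun h => by
    have := hfar u h
    rw [sub_self, norm_zero] at this
    linarith
  have hgood : good (insert u N) := by
    refine ⟨fun x hx => ?_, fun x hx y hy hxy => ?_⟩
    · rcases Finset.mem_insert.mp hx with rfl | h
      · exact hu
      · exact hN.1 x h
    · rcases Finset.mem_insert.mp hx with rfl | h <;> rcases Finset.mem_insert.mp hy with rfl | h'
      · exact absurd rfl hxy
      · exact hfar y h'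
      · rw [norm_sub_rev]; exact hfar x h
      · exact hN.2 x h y h' hxy
  have hc := hcard _ hgood
  have hci := Finset.card_insert_of_notMem huN
  exact Nat.find_min hex (m := 5 ^ n - (insert u N).card) (by omega) ⟨_, hgood, by omega⟩

/-- Approximating a top eigenvector by `x` costs a factor `2`, and approximating the direction of `A
x` by `y` another `2`. -/
theorem exists_net_opNorm_le {n : ℕ} {N : Finset (EuclideanSpace ℝ (Fin n))}
    (hN : ∀ u : EuclideanSpace ℝ (Fin n), ‖u‖ ≤ 1 → ∃ x ∈ N, ‖u - x‖ ≤ 1 / 2)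
    (hn : 0 < n) {A : Matrix (Fin n) (Fin n) ℝ} (hA : A.IsSymm) :
    ∃ x ∈ N, ∃ y ∈ N, opNorm A ≤ 4 * (y.ofLp ⬝ᵥ A.mulVec x.ofLp) := by
  set T := Matrix.toEuclideanCLM (n := Fin n) (𝕜 := ℝ) A with hT
  obtain ⟨u, m, hu, hm, hmA⟩ := exists_unit_eigenvector hn hA
  set u' : EuclideanSpace ℝ (Fin n) := WithLp.toLp 2 u with hu'
  have hun : ‖u'‖ = 1 := by
    rw [EuclideanSpace.norm_eq]; simp [hu', hu]
  have hTu : ‖T u'‖ = opNorm A := by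
    rw [hT, hu', Matrix.toEuclideanCLM_toLp, hm, WithLp.toLp_smul, norm_smul, ← hu', hun, mul_one,
      Real.norm_eq_abs, hmA]
  obtain ⟨x, hx, hux⟩ := hN u' hun.le
  have h1 : opNorm A / 2 ≤ ‖T x‖ := by
    have h2 : ‖T (u' - x)‖ ≤ opNorm A * (1 / 2) :=
      (T.le_opNorm _).trans (mul_le_mul_of_nonneg_left hux (norm_nonneg _))
    have h3 := norm_sub_norm_le (T u') (T x)
    rw [← map_sub, hTu] at h3
    linarith
  obtain ⟨y, hy, hyy⟩ := hN (‖T x‖⁻¹ • T x) (by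
    rw [norm_smul, norm_inv, norm_norm]
    exact inv_mul_le_one)
  refine ⟨x, hx, y, hy, ?_⟩
  have h4 : ‖T x‖ / 2 ≤ inner ℝ y (T x) := by
    have h5 : inner ℝ (‖T x‖⁻¹ • T x) (T x) = ‖T x‖ := by
      rw [real_inner_smul_left, real_inner_self_eq_norm_sq]
      rcases eq_or_ne ‖T x‖ 0 with h | h
      · simp [h]
      · field_simp
    have h6 := (real_inner_le_norm (‖T x‖⁻¹ • T x - y) (T x)).trans
      (mul_le_mul_of_nonneg_right hyy (norm_nonneg _))
    rw [inner_sub_left, h5] at h6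
    linarith
  have h7 : inner ℝ y (T x) = y.ofLp ⬝ᵥ A.mulVec x.ofLp := by
    rw [hT, Matrix.inner_toEuclideanCLM]
  rw [h7] at h4
  linarith

/-! ## The Efron–Stein inequality -/

theorem integral_comp_of_measurePreserving {α β : Type*} [MeasurableSpace α] [MeasurableSpace β]
    {μ : Measure α} {ν : Measure β} {g : α → β} (h : MeasurePreserving g μ ν) {f : β → ℝ}
    (hf : Measurable f) : ∫ x, f (g x) ∂μ = ∫ y, f y ∂ν := by
  rw [← h.map_eq, integral_map h.measurable.aemeasurable hf.aestronglyMeasurable]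

section EfronStein

variable {ι : Type*} [Fintype ι] [DecidableEq ι]

/-- From a sequence of pairs, the second entries at the indices in `A`, the first elsewhere. -/
def mix (A : Finset ι) (z : ι → ℝ × ℝ) : ι → ℝ := fun i => if i ∈ A then (z i).2 else (z i).1

/-- Swap the two entries of the pairs indexed by `A`. -/
def swapOn (A : Finset ι) (z : ι → ℝ × ℝ) : ι → ℝ × ℝ :=
  fun i => if i ∈ A then (z i).swap else z i

variable (μ : ι → Measure ℝ) [∀ i, IsProbabilityMeasure (μ i)]

theorem measurePreserving_mix (A : Finset ι) :
    MeasurePreserving (mix A) (Measure.pi fun i => (μ i).prod (μ i)) (Measure.pi μ) := by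
  refine measurePreserving_pi (μ := fun i => (μ i).prod (μ i)) (ν := μ)
    (f := fun i (p : ℝ × ℝ) => if i ∈ A then p.2 else p.1) fun i => ?_
  by_cases h : i ∈ A
  · simpa [h] using measurePreserving_snd
  · simpa [h] using measurePreserving_fst

theorem measurePreserving_swapOn (A : Finset ι) :
    MeasurePreserving (swapOn A) (Measure.pi fun i => (μ i).prod (μ i))
      (Measure.pi fun i => (μ i).prod (μ i)) := by
  refine measurePreserving_pi (μ := fun i => (μ i).prod (μ i)) (ν := fun i => (μ i).prod (μ i))
    (f := fun i (p : ℝ × ℝ) => if i ∈ A then p.swap else p) fun i => ?_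
  by_cases h : i ∈ A
  · simpa [h] using Measure.measurePreserving_swap
  · simp only [h, if_false]; exact MeasurePreserving.id ((μ i).prod (μ i))

theorem mix_swapOn {ι : Type*} [DecidableEq ι] (A B : Finset ι) (z : ι → ℝ × ℝ) :
    mix A (swapOn B z) = mix (symmDiff A B) z := by
  ext i
  by_cases hA : i ∈ A <;> by_cases hB : i ∈ B <;> simp [mix, swapOn, hA, hB, Finset.mem_symmDiff]

variable {μ} {f : (ι → ℝ) → ℝ}

theorem memLp_comp_mix (hf : MemLp f 2 (Measure.pi μ)) (A : Finset ι) :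
    MemLp (fun z => f (mix A z)) 2 (Measure.pi fun i => (μ i).prod (μ i)) :=
  hf.comp_measurePreserving (measurePreserving_mix μ A)

/-- Resample the coordinates of `A` one at a time. Swapping pair `k` reverses the sign of the
increment, so its integral against `f (mix ∅ z)` is half its integral against `f (mix ∅ z) - f (mix
{k} z)`. By `swapOn A` both differences have the same second moment, and the arithmetic–geometric
mean inequality concludes. -/
theorem integral_mul_mix_sub_le (hm : Measurable f) (hf : MemLp f 2 (Measure.pi μ))
    (A : Finset ι) :
    ∫ z, f (mix ∅ z) * (f (mix ∅ z) - f (mix A z)) ∂(Measure.pi fun i => (μ i).prod (μ i)) ≤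
      ∑ k ∈ A, 1 / 2 * ∫ z, (f (mix ∅ z) - f (mix {k} z)) ^ 2
        ∂(Measure.pi fun i => (μ i).prod (μ i)) := by
  set ν := Measure.pi fun i => (μ i).prod (μ i) with hν
  have hmm : ∀ B : Finset ι, Measurable fun z => f (mix B z) := fun B =>
    hm.comp (measurePreserving_mix μ B).measurable
  have hL := memLp_comp_mix (μ := μ) hf
  induction A using Finset.induction_on with
  | empty => simp
  | insert k A hk ih =>
    rw [Finset.sum_insert hk]
    have i1 : Integrable (fun z => f (mix ∅ z) * (f (mix ∅ z) - f (mix A z))) ν :=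
      (hL ∅).integrable_mul ((hL ∅).sub (hL A))
    have i2 : ∀ B : Finset ι,
        Integrable (fun z => f (mix B z) * (f (mix A z) - f (mix (insert k A) z))) ν := fun B =>
      (hL B).integrable_mul ((hL A).sub (hL _))
    have e1 : ∫ z, f (mix ∅ z) * (f (mix ∅ z) - f (mix (insert k A) z)) ∂ν =
        ∫ z, f (mix ∅ z) * (f (mix ∅ z) - f (mix A z)) ∂ν +
        ∫ z, f (mix ∅ z) * (f (mix A z) - f (mix (insert k A) z)) ∂ν := by
      rw [← integral_add i1 (i2 ∅)]
      congr 1; ext z; ring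
    have sd1 : symmDiff (∅ : Finset ι) {k} = {k} := by ext i; simp [Finset.mem_symmDiff]
    have sd2 : symmDiff A {k} = insert k A := by
      ext i; simp only [Finset.mem_symmDiff, Finset.mem_singleton, Finset.mem_insert]
      by_cases h : i = k
      · subst h; simp [hk]
      · simp [h]
    have sd3 : symmDiff (insert k A) {k} = A := by
      rw [← sd2, symmDiff_assoc, symmDiff_self]; simp
    have sd4 : symmDiff (∅ : Finset ι) A = A := by ext i; simp [Finset.mem_symmDiff]
    have sd5 : symmDiff {k} A = insert k A := by rw [symmDiff_comm, sd2]
    have e2 : ∫ z, f (mix ∅ z) * (f (mix A z) - f (mix (insert k A) z)) ∂ν =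
        - ∫ z, f (mix {k} z) * (f (mix A z) - f (mix (insert k A) z)) ∂ν := by
      have h := integral_comp_of_measurePreserving (measurePreserving_swapOn μ {k})
        (f := fun z => f (mix ∅ z) * (f (mix A z) - f (mix (insert k A) z)))
        ((hmm _).mul ((hmm _).sub (hmm _)))
      simp only [mix_swapOn, sd1, sd2, sd3] at h
      rw [← h, ← integral_neg]
      congr 1; ext z; ring
    have e3 : ∫ z, (f (mix A z) - f (mix (insert k A) z)) ^ 2 ∂ν =
        ∫ z, (f (mix ∅ z) - f (mix {k} z)) ^ 2 ∂ν := by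
      have h := integral_comp_of_measurePreserving (measurePreserving_swapOn μ A)
        (f := fun z => (f (mix ∅ z) - f (mix {k} z)) ^ 2) (((hmm ∅).sub (hmm {k})).pow_const 2)
      simpa only [mix_swapOn, sd4, sd5] using h
    have e4 : ∫ z, f (mix ∅ z) * (f (mix A z) - f (mix (insert k A) z)) ∂ν ≤
        1 / 2 * ∫ z, (f (mix ∅ z) - f (mix {k} z)) ^ 2 ∂ν := by
      have h1 : 2 * ∫ z, f (mix ∅ z) * (f (mix A z) - f (mix (insert k A) z)) ∂ν =
          ∫ z, (f (mix ∅ z) - f (mix {k} z)) * (f (mix A z) - f (mix (insert k A) z)) ∂ν := by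
        rw [two_mul]
        nth_rewrite 2 [e2]
        rw [← sub_eq_add_neg, ← integral_sub (i2 ∅) (i2 {k})]
        congr 1; ext z; ring
      have s1 : Integrable (fun z => (f (mix ∅ z) - f (mix {k} z)) ^ 2) ν :=
        ((hL _).sub (hL _)).integrable_sq
      have s2 : Integrable (fun z => (f (mix A z) - f (mix (insert k A) z)) ^ 2) ν :=
        ((hL _).sub (hL _)).integrable_sq
      have h2 : ∫ z, (f (mix ∅ z) - f (mix {k} z)) * (f (mix A z) - f (mix (insert k A) z)) ∂ν ≤
          ∫ z, (1 / 2 * (f (mix ∅ z) - f (mix {k} z)) ^ 2 +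
            1 / 2 * (f (mix A z) - f (mix (insert k A) z)) ^ 2) ∂ν := by
        refine integral_mono (((hL _).sub (hL _)).integrable_mul ((hL _).sub (hL _)))
          ((s1.const_mul _).add (s2.const_mul _)) fun z => ?_
        dsimp only [Pi.mul_apply, Pi.sub_apply]
        nlinarith [sq_nonneg ((f (mix ∅ z) - f (mix {k} z)) -
          (f (mix A z) - f (mix (insert k A) z)))]
      rw [integral_add (s1.const_mul _) (s2.const_mul _), integral_const_mul,
        integral_const_mul, e3] at h2
      linarith
    linarith

theorem integral_mul_mix_univ (hm : Measurable f) :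
    ∫ z, f (mix ∅ z) * f (mix Finset.univ z) ∂(Measure.pi fun i => (μ i).prod (μ i)) =
      (∫ x, f x ∂(Measure.pi μ)) ^ 2 := by
  have hind : IndepFun (fun z : ι → ℝ × ℝ => mix ∅ z) (fun z => mix Finset.univ z)
      (Measure.pi fun i => (μ i).prod (μ i)) := by
    rw [indepFun_iff_map_prod_eq_prod_map_map (measurePreserving_mix μ _).measurable.aemeasurable
      (measurePreserving_mix μ _).measurable.aemeasurable, (measurePreserving_mix μ _).map_eq,
      (measurePreserving_mix μ _).map_eq]
    convert (measurePreserving_arrowProdEquivProdArrow ℝ ℝ ι μ μ).map_eq using 2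
    ext z
    · simp [mix, MeasurableEquiv.arrowProdEquivProdArrow, Equiv.arrowProdEquivProdArrow]
    · simp [mix, MeasurableEquiv.arrowProdEquivProdArrow, Equiv.arrowProdEquivProdArrow]
  have h := (hind.comp hm hm).integral_mul_eq_mul_integral
    (hm.comp (measurePreserving_mix μ _).measurable).aestronglyMeasurable
    (hm.comp (measurePreserving_mix μ _).measurable).aestronglyMeasurable
  have e : ∀ A : Finset ι, ∫ z, (f ∘ fun z => mix A z) z
      ∂(Measure.pi fun i => (μ i).prod (μ i)) = ∫ x, f x ∂(Measure.pi μ) := fun A =>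
    integral_comp_of_measurePreserving (measurePreserving_mix μ A) hm
  rw [e, e] at h
  rw [sq, ← h]
  rfl

theorem variance_le_sum_integral_sq_sub (hm : Measurable f) (hf : MemLp f 2 (Measure.pi μ)) :
    variance f (Measure.pi μ) ≤ ∑ k, 1 / 2 * ∫ z, (f (mix ∅ z) - f (mix {k} z)) ^ 2
        ∂(Measure.pi fun i => (μ i).prod (μ i)) := by
  refine le_trans (le_of_eq ?_) (integral_mul_mix_sub_le hm hf Finset.univ)
  have hL := memLp_comp_mix (μ := μ) hf
  have hi : ∀ B : Finset ι, Integrable (fun z => f (mix ∅ z) * f (mix B z))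
      (Measure.pi fun i => (μ i).prod (μ i)) := fun B => (hL ∅).integrable_mul (hL B)
  simp only [mul_sub]
  rw [integral_sub (hi ∅) (hi _), integral_mul_mix_univ hm, variance_eq_sub hf,
    ← integral_comp_of_measurePreserving (f := f ^ 2) (measurePreserving_mix μ ∅) (hm.pow_const 2)]
  simp [sq]

/-- The **Efron–Stein inequality**, with a pointwise bound on the sum of the squared positive
parts of the differences. -/
theorem variance_le_integral_of_sum_sq_posPart_le (hm : Measurable f)
    (hf : MemLp f 2 (Measure.pi μ)) {g : (ι → ℝ × ℝ) → ℝ}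
    (hg : Integrable g (Measure.pi fun i => (μ i).prod (μ i)))
    (hle : ∀ z, ∑ k, (max (f (mix ∅ z) - f (mix {k} z)) 0) ^ 2 ≤ g z) :
    variance f (Measure.pi μ) ≤ ∫ z, g z ∂(Measure.pi fun i => (μ i).prod (μ i)) := by
  set ν := Measure.pi fun i => (μ i).prod (μ i) with hν
  have hL := memLp_comp_mix (μ := μ) hf
  have hmm : ∀ B : Finset ι, Measurable fun z => f (mix B z) := fun B =>
    hm.comp (measurePreserving_mix μ B).measurable
  have hmax : ∀ A B : Finset ι,
      Integrable (fun z => (max (f (mix A z) - f (mix B z)) 0) ^ 2) ν := fun A B => by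
    refine (((hL A).sub (hL B)).integrable_sq).mono
      ((((hmm A).sub (hmm B)).max measurable_const).pow_const 2).aestronglyMeasurable
      (Filter.Eventually.of_forall fun z => ?_)
    simp only [Real.norm_eq_abs, Pi.sub_apply, abs_pow, sq_abs]
    rcases le_total (f (mix A z) - f (mix B z)) 0 with h | h
    · rw [max_eq_right h, zero_pow two_ne_zero]; positivity
    · rw [max_eq_left h]
  refine le_trans ?_ (integral_mono (integrable_finsetSum _ fun k _ => hmax ∅ {k}) hg hle)
  rw [integral_finsetSum _ fun k _ => hmax ∅ {k}]
  refine (variance_le_sum_integral_sq_sub hm hf).trans (Finset.sum_le_sum fun k _ => ?_)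
  have sd1 : symmDiff (∅ : Finset ι) {k} = {k} := by ext i; simp [Finset.mem_symmDiff]
  -- Swapping pair `k` exchanges increases and decreases, so the decreases alone carry half the
  -- squared difference and the factor `1/2` disappears.
  have e : ∫ z, (max (f (mix {k} z) - f (mix ∅ z)) 0) ^ 2 ∂ν =
      ∫ z, (max (f (mix ∅ z) - f (mix {k} z)) 0) ^ 2 ∂ν := by
    have h := integral_comp_of_measurePreserving (measurePreserving_swapOn μ {k})
      (f := fun z => (max (f (mix ∅ z) - f (mix {k} z)) 0) ^ 2)
      ((((hmm ∅).sub (hmm {k})).max measurable_const).pow_const 2)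
    simpa only [mix_swapOn, sd1, symmDiff_self, Finset.bot_eq_empty] using h
  have e2 : ∫ z, (f (mix ∅ z) - f (mix {k} z)) ^ 2 ∂ν =
      ∫ z, (max (f (mix ∅ z) - f (mix {k} z)) 0) ^ 2 ∂ν +
      ∫ z, (max (f (mix {k} z) - f (mix ∅ z)) 0) ^ 2 ∂ν := by
    rw [← integral_add (hmax _ _) (hmax _ _)]
    congr 1; ext z
    rcases le_total (f (mix ∅ z)) (f (mix {k} z)) with h | h
    · rw [max_eq_right (by linarith), max_eq_left (by linarith)]; ring
    · rw [max_eq_left (by linarith), max_eq_right (by linarith)]; ring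
  rw [e2, e]
  linarith

end EfronStein

/-! ## Symmetric matrices from their upper triangles -/

/-- The positions on and above the diagonal. -/
abbrev Upper (n : ℕ) : Type := {p : Fin n × Fin n // p.1 ≤ p.2}

/-- The symmetric matrix with the given upper triangle. -/
def symMat {n : ℕ} (x : Upper n → ℝ) : Matrix (Fin n) (Fin n) ℝ :=
  Matrix.of fun i j => if h : i ≤ j then x ⟨(i, j), h⟩ else x ⟨(j, i), (not_le.mp h).le⟩

theorem symMat_isSymm {n : ℕ} (x : Upper n → ℝ) : (symMat x).IsSymm := by
  ext i j
  simp only [symMat, Matrix.transpose_apply, Matrix.of_apply]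
  rcases lt_trichotomy i j with h | rfl | h
  · rw [dif_neg (not_le.mpr h), dif_pos h.le]
  · rfl
  · rw [dif_pos h.le, dif_neg (not_le.mpr h)]

theorem symMat_upper {n : ℕ} {A : Matrix (Fin n) (Fin n) ℝ} (hA : A.IsSymm) :
    symMat (fun p : Upper n => A p.1.1 p.1.2) = A := by
  ext i j
  simp only [symMat, Matrix.of_apply]
  split_ifs
  · rfl
  · exact hA.apply _ _

/-- The sum of `F` over the position `p` and its mirror image. -/
def mirrorSum {n : ℕ} (F : Fin n → Fin n → ℝ) (p : Upper n) : ℝ :=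
  if p.1.1 = p.1.2 then F p.1.1 p.1.1 else F p.1.1 p.1.2 + F p.1.2 p.1.1

theorem sum_mirrorSum {n : ℕ} (F : Fin n → Fin n → ℝ) :
    ∑ p, mirrorSum F p = ∑ i, ∑ j, F i j := by
  have h1 : ∑ p, mirrorSum F p = ∑ q : Fin n × Fin n, if q.1 ≤ q.2 then
      (if q.1 = q.2 then F q.1 q.1 else F q.1 q.2 + F q.2 q.1) else 0 := by
    rw [← Finset.sum_filter]
    exact (Finset.sum_subtype (Finset.univ.filter fun q : Fin n × Fin n => q.1 ≤ q.2) (by simp)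
      (fun q => if q.1 = q.2 then F q.1 q.1 else F q.1 q.2 + F q.2 q.1)).symm
  have h2 : ∑ i, ∑ j, (if i < j then F j i else 0) = ∑ i, ∑ j, if j < i then F i j else 0 :=
    Finset.sum_comm
  have h3 : ∑ i, ∑ j, F i j =
      ∑ i, ∑ j, (if i ≤ j then F i j else 0) + ∑ i, ∑ j, if i < j then F j i else 0 := by
    rw [h2, ← Finset.sum_add_distrib]
    refine Finset.sum_congr rfl fun i _ => ?_
    rw [← Finset.sum_add_distrib]
    refine Finset.sum_congr rfl fun j _ => ?_
    rcases le_or_gt i j with h | h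
    · simp [h, not_lt.mpr h]
    · simp [h, not_le.mpr h]
  rw [h1, Fintype.sum_prod_type, h3, ← Finset.sum_add_distrib]
  refine Finset.sum_congr rfl fun i _ => ?_
  rw [← Finset.sum_add_distrib]
  refine Finset.sum_congr rfl fun j _ => ?_
  rcases lt_trichotomy i j with h | rfl | h
  · simp [h, h.le, h.ne]
  · simp
  · simp [not_le.mpr h, not_lt.mpr h.le]

theorem dotProduct_symMat_mulVec {n : ℕ} (x : Upper n → ℝ) (u v : Fin n → ℝ) :
    u ⬝ᵥ (symMat x).mulVec v = ∑ p, mirrorSum (fun i j => u i * v j) p * x p := by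
  have h : u ⬝ᵥ (symMat x).mulVec v = ∑ i, ∑ j, u i * symMat x i j * v j := by
    simp only [dotProduct, Matrix.mulVec, Finset.mul_sum, mul_assoc]
  rw [h, ← sum_mirrorSum]
  refine Finset.sum_congr rfl fun p _ => ?_
  obtain ⟨⟨i, j⟩, hij⟩ := p
  simp only [mirrorSum, symMat, Matrix.of_apply]
  dsimp only at hij
  rcases hij.eq_or_lt with h | h
  · subst h; simp; ring
  · simp [h.ne, h.le, not_le.mpr h]; ring

theorem sum_mirrorSum_mul_sq_le {n : ℕ} (u v : Fin n → ℝ) :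
    ∑ p, mirrorSum (fun i j => u i * v j) p ^ 2 ≤ 2 * ((∑ i, u i ^ 2) * ∑ i, v i ^ 2) := by
  rw [Finset.sum_mul_sum, ← sum_mirrorSum, Finset.mul_sum]
  refine Finset.sum_le_sum fun p _ => ?_
  simp only [mirrorSum]
  split_ifs
  · nlinarith [sq_nonneg (u p.1.1 * v p.1.1)]
  · nlinarith [sq_nonneg (u p.1.1 * v p.1.2 - u p.1.2 * v p.1.1)]

theorem continuous_symMat {n : ℕ} : Continuous (symMat (n := n)) := by
  refine continuous_pi fun i => continuous_pi fun j => ?_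
  simp only [symMat, Matrix.of_apply]
  split_ifs
  · exact continuous_apply _
  · exact continuous_apply _

/-- The top eigenvector `u` of the original matrix is a test vector for all the resampled ones, so
resampling entry `k` lowers the norm by at most `|a k|` times the change of the entry, where `∑ a k
^ 2 ≤ 2`. As `a` depends on the sample, the entries are truncated at `θ`: small changes cost `2 θ`
in total, large ones are paid by sixth powers regardless of `a`. -/
theorem sum_sq_posPart_opNorm_le {n : ℕ} (hn : 0 < n) {θ : ℝ} (hθ : 0 < θ)
    (z : Upper n → ℝ × ℝ) :
    ∑ k, (max (opNorm (symMat (mix ∅ z)) - opNorm (symMat (mix {k} z))) 0) ^ 2 ≤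
      2 * θ + ∑ k, 64 / θ ^ 2 * ((z k).1 ^ 6 + (z k).2 ^ 6) := by
  obtain ⟨u, m, hu, hm, hmA⟩ := exists_unit_eigenvector hn (symMat_isSymm (mix ∅ z))
  set a : Upper n → ℝ := mirrorSum fun i j => u i * u j with ha
  have hasum : ∑ k, a k ^ 2 ≤ 2 := by
    have := sum_mirrorSum_mul_sq_le u u
    rw [hu] at this
    linarith
  have hak : ∀ k, a k ^ 2 ≤ 2 := fun k =>
    (Finset.single_le_sum (fun k _ => sq_nonneg (a k)) (Finset.mem_univ k)).trans hasum
  have hdiff : ∀ k, max (opNorm (symMat (mix ∅ z)) - opNorm (symMat (mix {k} z))) 0 ≤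
      |a k * ((z k).1 - (z k).2)| := fun k => by
    refine max_le ?_ (abs_nonneg _)
    have h1 : opNorm (symMat (mix ∅ z)) = |u ⬝ᵥ (symMat (mix ∅ z)).mulVec u| := by
      have hu' : u ⬝ᵥ u = 1 := by rw [← hu]; simp [dotProduct, sq]
      rw [hm, dotProduct_smul, hu', smul_eq_mul, mul_one, hmA]
    have h2 := abs_dotProduct_mulVec_le (symMat (mix {k} z)) hu
    have h3 : u ⬝ᵥ (symMat (mix ∅ z)).mulVec u - u ⬝ᵥ (symMat (mix {k} z)).mulVec u =
        a k * ((z k).1 - (z k).2) := by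
      rw [dotProduct_symMat_mulVec, dotProduct_symMat_mulVec, ← Finset.sum_sub_distrib,
        Finset.sum_eq_single k]
      · simp [mix, ha]; ring
      · intro j _ hj
        simp [mix, hj]
      · simp
    have h4 := abs_sub_abs_le_abs_sub (u ⬝ᵥ (symMat (mix ∅ z)).mulVec u)
      (u ⬝ᵥ (symMat (mix {k} z)).mulVec u)
    rw [h3] at h4
    linarith
  have hpt : ∀ d : ℝ, d ^ 2 ≤ θ + d ^ 6 / θ ^ 2 := fun d => by
    rw [← sub_le_iff_le_add', le_div_iff₀ (by positivity)]
    have e : d ^ 6 = d ^ 2 * d ^ 2 * d ^ 2 := by ring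
    rw [e]
    set b := d ^ 2
    have hb : 0 ≤ b := sq_nonneg d
    rcases le_total b θ with h | h
    · have : (b - θ) * θ ^ 2 ≤ 0 := mul_nonpos_of_nonpos_of_nonneg (by linarith) (by positivity)
      have : 0 ≤ b * b * b := by positivity
      linarith
    · have h5 : θ ^ 2 ≤ b * b := by nlinarith
      have h6 := mul_le_mul_of_nonneg_right h5 hb
      nlinarith [pow_pos hθ 3]
  have hd6 : ∀ x y : ℝ, (x - y) ^ 6 ≤ 32 * (x ^ 6 + y ^ 6) := fun x y => by
    have h := add_pow_le (abs_nonneg x) (abs_nonneg y) 6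
    have e : ∀ t : ℝ, |t| ^ 6 = t ^ 6 := fun t => (by decide : Even 6).pow_abs t
    rw [e, e] at h
    calc (x - y) ^ 6 = |x - y| ^ 6 := (e _).symm
      _ ≤ (|x| + |y|) ^ 6 := pow_le_pow_left₀ (abs_nonneg _) (abs_sub x y) 6
      _ ≤ _ := h.trans (by norm_num)
  have hterm : ∀ k, (max (opNorm (symMat (mix ∅ z)) - opNorm (symMat (mix {k} z))) 0) ^ 2 ≤
      a k ^ 2 * θ + 64 / θ ^ 2 * ((z k).1 ^ 6 + (z k).2 ^ 6) := fun k => by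
    set d := (z k).1 - (z k).2 with hd
    calc _ ≤ |a k * d| ^ 2 := pow_le_pow_left₀ (le_max_right _ _) (hdiff k) 2
      _ = a k ^ 2 * d ^ 2 := by rw [sq_abs, mul_pow]
      _ ≤ a k ^ 2 * (θ + d ^ 6 / θ ^ 2) := mul_le_mul_of_nonneg_left (hpt d) (sq_nonneg _)
      _ = a k ^ 2 * θ + a k ^ 2 * (d ^ 6 / θ ^ 2) := by ring
      _ ≤ a k ^ 2 * θ + 2 * (32 * ((z k).1 ^ 6 + (z k).2 ^ 6) / θ ^ 2) := by
          gcongr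
          · exact hak k
          · exact hd6 _ _
      _ = _ := by ring
  refine (Finset.sum_le_sum fun k _ => hterm k).trans ?_
  rw [Finset.sum_add_distrib, ← Finset.sum_mul]
  gcongr

/-! ## Moments of the operator norm -/

section RandomMatrix

variable {n : ℕ} {Ω : Type*} [MeasurableSpace Ω] {σ : ℝ} {P : Measure Ω}
  {X : Ω → Matrix (Fin n) (Fin n) ℝ}

theorem measurable_opNorm_symMat : Measurable fun x : Upper n → ℝ => opNorm (symMat x) :=
  (continuous_opNorm.comp continuous_symMat).measurable

theorem IsSymmetricIID.measurable_upper (hX : IsSymmetricIID σ P X) :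
    Measurable fun ω (p : Upper n) => X ω p.1.1 p.1.2 :=
  measurable_pi_lambda _ fun _ => hX.meas _ _

theorem IsSymmetricIID.opNorm_eq (hX : IsSymmetricIID σ P X) :
    (fun ω => opNorm (X ω)) =
      (fun x : Upper n → ℝ => opNorm (symMat x)) ∘ fun ω p => X ω p.1.1 p.1.2 := by
  ext ω
  simp only [Function.comp]
  rw [symMat_upper (hX.symm ω)]

theorem IsSymmetricIID.measurable_opNorm (hX : IsSymmetricIID σ P X) :
    Measurable fun ω => opNorm (X ω) := by
  rw [hX.opNorm_eq]
  exact measurable_opNorm_symMat.comp hX.measurable_upper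

theorem IsSymmetricIID.memLp_entry (hX : IsSymmetricIID σ P X) (i j : Fin n) :
    MemLp (fun ω => X ω i j) 2 P := by
  rw [memLp_two_iff_integrable_sq (hX.meas i j).aestronglyMeasurable]
  simpa only [mul_one] using ((hX.subgaussian i j).integral_even_le 1).1

theorem IsSymmetricIID.memLp_opNorm (hX : IsSymmetricIID σ P X) :
    MemLp (fun ω => opNorm (X ω)) 2 P := by
  have h : MemLp (fun ω => ∑ i, ∑ j, |X ω i j|) 2 P :=
    memLp_finsetSum _ fun i _ => memLp_finsetSum _ fun j _ => (hX.memLp_entry i j).abs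
  refine h.mono hX.measurable_opNorm.aestronglyMeasurable (Filter.Eventually.of_forall fun ω => ?_)
  rw [Real.norm_of_nonneg (opNorm_nonneg _)]
  exact (opNorm_le_sum_abs _).trans (Real.le_norm_self _)

theorem IsSymmetricIID.integral_sq_entry (hX : IsSymmetricIID σ P X) (i j : Fin n) :
    ∫ ω, X ω i j ^ 2 ∂P = 1 / n := by
  rw [← hX.var i j, variance_of_integral_eq_zero (hX.meas i j).aemeasurable
    (hX.subgaussian i j).1]

/-- The norm dominates that of a single column, whose expected square is `n * (1 / n)`. -/
theorem IsSymmetricIID.one_le_integral_sq_opNorm (hX : IsSymmetricIID σ P X) (hn : 0 < n) :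
    1 ≤ ∫ ω, opNorm (X ω) ^ 2 ∂P := by
  set j : Fin n := ⟨0, hn⟩
  have h1 : ∀ ω, ∑ i, X ω i j ^ 2 ≤ opNorm (X ω) ^ 2 := fun ω => by
    have h := sum_sq_mulVec_le (X ω) (Pi.single j 1)
    have e : ∑ i, (Pi.single j (1 : ℝ) : Fin n → ℝ) i ^ 2 = 1 := by
      rw [Finset.sum_eq_single j] <;> simp +contextual
    rw [e, mul_one] at h
    simpa [Matrix.mulVec_single] using h
  have hi : ∀ i, Integrable (fun ω => X ω i j ^ 2) P := fun i => (hX.memLp_entry i j).integrable_sq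
  calc (1 : ℝ) = ∑ i, ∫ ω, X ω i j ^ 2 ∂P := by
        simp only [hX.integral_sq_entry, Finset.sum_const, Finset.card_univ, Fintype.card_fin,
          nsmul_eq_mul]
        field_simp
    _ = ∫ ω, ∑ i, X ω i j ^ 2 ∂P := (integral_finsetSum _ fun i _ => hi i).symm
    _ ≤ _ := integral_mono (integrable_finsetSum _ fun i _ => hi i)
        hX.memLp_opNorm.integrable_sq h1

variable [IsProbabilityMeasure P]

/-- Sixth moments are at most `216 σ ^ 6 / n ^ 3`, so at most `n ^ 2` positions with two copies each
contribute `O(1 / n)`; `27648 = 64 * 432`. -/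
theorem IsSymmetricIID.variance_opNorm_le (hX : IsSymmetricIID σ P X) (hn : 0 < n) {θ : ℝ}
    (hθ : 0 < θ) :
    variance (fun ω => opNorm (X ω)) P ≤ 2 * θ + 27648 * σ ^ 6 / (θ ^ 2 * n) := by
  have hn' : (0 : ℝ) < n := by exact_mod_cast hn
  set μ : Upper n → Measure ℝ := fun p => P.map fun ω => X ω p.1.1 p.1.2 with hμ
  have hprob : ∀ p, IsProbabilityMeasure (μ p) := fun p =>
    Measure.isProbabilityMeasure_map (hX.meas _ _).aemeasurable
  have hmap : P.map (fun ω (p : Upper n) => X ω p.1.1 p.1.2) = Measure.pi μ :=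
    (iIndepFun_iff_map_fun_eq_pi_map fun p => (hX.meas _ _).aemeasurable).mp hX.indep
  have hL : MemLp (fun x : Upper n → ℝ => opNorm (symMat x)) 2 (Measure.pi μ) := by
    rw [← hmap, memLp_map_measure_iff measurable_opNorm_symMat.aestronglyMeasurable
      hX.measurable_upper.aemeasurable, ← hX.opNorm_eq]
    exact hX.memLp_opNorm
  have h6 : ∀ p, Integrable (fun t : ℝ => t ^ 6) (μ p) ∧
      ∫ t, t ^ 6 ∂(μ p) ≤ 216 * σ ^ 6 / n ^ 3 := fun p => by
    have hs := (hX.subgaussian p.1.1 p.1.2).integral_even_le 3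
    have hc : Continuous fun t : ℝ => t ^ 6 := continuous_pow 6
    constructor
    · rw [hμ, integrable_map_measure hc.aestronglyMeasurable (hX.meas _ _).aemeasurable]
      exact hs.1
    · rw [hμ, integral_map (hX.meas _ _).aemeasurable hc.aestronglyMeasurable]
      refine hs.2.trans (le_of_eq ?_)
      rw [div_pow, Real.sq_sqrt hn'.le]
      push_cast
      field_simp
      ring
  have hfst : ∀ k, MeasurePreserving (fun z : Upper n → ℝ × ℝ => (z k).1)
      (Measure.pi fun i => (μ i).prod (μ i)) (μ k) := fun k =>
    measurePreserving_fst.comp (measurePreserving_eval (fun i => (μ i).prod (μ i)) k)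
  have hsnd : ∀ k, MeasurePreserving (fun z : Upper n → ℝ × ℝ => (z k).2)
      (Measure.pi fun i => (μ i).prod (μ i)) (μ k) := fun k =>
    measurePreserving_snd.comp (measurePreserving_eval (fun i => (μ i).prod (μ i)) k)
  have hi1 : ∀ k, Integrable (fun z : Upper n → ℝ × ℝ => (z k).1 ^ 6)
      (Measure.pi fun i => (μ i).prod (μ i)) := fun k =>
    (hfst k).integrable_comp_of_integrable (h6 k).1
  have hi2 : ∀ k, Integrable (fun z : Upper n → ℝ × ℝ => (z k).2 ^ 6)
      (Measure.pi fun i => (μ i).prod (μ i)) := fun k =>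
    (hsnd k).integrable_comp_of_integrable (h6 k).1
  have hik : ∀ k, Integrable (fun z : Upper n → ℝ × ℝ =>
      64 / θ ^ 2 * ((z k).1 ^ 6 + (z k).2 ^ 6)) (Measure.pi fun i => (μ i).prod (μ i)) :=
    fun k => ((hi1 k).add (hi2 k)).const_mul _
  have hES := variance_le_integral_of_sum_sq_posPart_le measurable_opNorm_symMat hL
    ((integrable_const (2 * θ)).add (integrable_finsetSum _ fun k _ => hik k))
    (sum_sq_posPart_opNorm_le hn hθ)
  have hvar : variance (fun ω => opNorm (X ω)) P =
      variance (fun x : Upper n → ℝ => opNorm (symMat x)) (Measure.pi μ) := by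
    rw [← hmap, variance_map measurable_opNorm_symMat.aemeasurable
      hX.measurable_upper.aemeasurable, hX.opNorm_eq]
  rw [hvar]
  refine hES.trans ?_
  have hk : ∀ k, ∫ z : Upper n → ℝ × ℝ, 64 / θ ^ 2 * ((z k).1 ^ 6 + (z k).2 ^ 6)
      ∂(Measure.pi fun i => (μ i).prod (μ i)) ≤ 64 / θ ^ 2 * (432 * σ ^ 6 / n ^ 3) := fun k => by
    rw [integral_const_mul, integral_add (hi1 k) (hi2 k),
      integral_comp_of_measurePreserving (f := fun t => t ^ 6) (hfst k) (by fun_prop),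
      integral_comp_of_measurePreserving (f := fun t => t ^ 6) (hsnd k) (by fun_prop)]
    gcongr
    have := (h6 k).2
    calc _ ≤ 216 * σ ^ 6 / n ^ 3 + 216 * σ ^ 6 / (n : ℝ) ^ 3 := add_le_add this this
      _ = _ := by ring
  have hcard : (Fintype.card (Upper n) : ℝ) ≤ n ^ 2 := by
    have := Fintype.card_subtype_le fun p : Fin n × Fin n => p.1 ≤ p.2
    rw [Fintype.card_prod, Fintype.card_fin, ← sq] at this
    exact_mod_cast this
  simp only [Pi.add_apply]
  rw [integral_add (integrable_const _) (integrable_finsetSum _ fun k _ => hik k),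
    integral_finsetSum _ fun k _ => hik k]
  simp only [integral_const, probReal_univ, one_smul]
  gcongr
  calc _ ≤ ∑ _k : Upper n, 64 / θ ^ 2 * (432 * σ ^ 6 / (n : ℝ) ^ 3) :=
        Finset.sum_le_sum fun k _ => hk k
    _ = Fintype.card (Upper n) * (64 / θ ^ 2 * (432 * σ ^ 6 / (n : ℝ) ^ 3)) := by simp
    _ ≤ (n : ℝ) ^ 2 * (64 / θ ^ 2 * (432 * σ ^ 6 / (n : ℝ) ^ 3)) := by gcongr
    _ = _ := by field_simp; ring

theorem IsSymmetricIID.integral_opNorm_le (hX : IsSymmetricIID σ P X) (hn : 0 < n) :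
    ∫ ω, opNorm (X ω) ∂P ≤ 4 * (Real.log 25 + 10 * Real.exp 1 * σ ^ 2 + 1) := by
  have hn' : (0 : ℝ) < n := by exact_mod_cast hn
  have hn1 : (1 : ℝ) ≤ n := by exact_mod_cast hn
  set L : ℝ := Real.log 25 + 10 * Real.exp 1 * σ ^ 2 with hL
  obtain ⟨N, hNcard, hN1, hN⟩ := exists_net n
  set q : EuclideanSpace ℝ (Fin n) → EuclideanSpace ℝ (Fin n) → Ω → ℝ :=
    fun x y ω => y.ofLp ⬝ᵥ (X ω).mulVec x.ofLp with hq
  have hsq : ∀ x ∈ N, ∑ i, x.ofLp i ^ 2 ≤ 1 := fun x hx => by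
    have h := EuclideanSpace.norm_sq_eq x
    simp only [Real.norm_eq_abs, sq_abs] at h
    rw [← h]
    exact pow_le_one₀ (norm_nonneg _) (hN1 x hx)
  have hmgf : ∀ x ∈ N, ∀ y ∈ N, Integrable (fun ω => Real.exp (n * q x y ω)) P ∧
      ∫ ω, Real.exp (n * q x y ω) ∂P ≤ Real.exp (n * (10 * Real.exp 1 * σ ^ 2)) := by
    intro x hx y hy
    set a : Upper n → ℝ := mirrorSum fun i j => y.ofLp i * x.ofLp j with ha
    have hqa : q x y = fun ω => ∑ p : Upper n, a p * X ω p.1.1 p.1.2 := by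
      ext ω
      rw [hq]
      dsimp only
      rw [← symMat_upper (hX.symm ω), dotProduct_symMat_mulVec]
      simp only [symMat_upper (hX.symm ω), ha]
    have hasum : ∑ p, a p ^ 2 ≤ 2 := by
      have h := sum_mirrorSum_mul_sq_le y.ofLp x.ofLp
      have := mul_le_mul (hsq y hy) (hsq x hx) (Finset.sum_nonneg fun _ _ => sq_nonneg _) one_pos.le
      linarith
    have hind : iIndepFun (fun (p : Upper n) ω => a p * X ω p.1.1 p.1.2) P :=
      hX.indep.comp (fun p t => a p * t) fun p => measurable_const_mul (a p)
    have hterm : ∀ p : Upper n, HasSubgaussianMGF (fun ω => a p * X ω p.1.1 p.1.2)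
        (Real.toNNReal (a p ^ 2) * Real.toNNReal (10 * Real.exp 1 * (σ / √n) ^ 2)) P := fun p => by
      convert ((hX.subgaussian p.1.1 p.1.2).hasSubgaussianMGF (hX.meas _ _)).const_mul (a p) using 2
      exact congrArg (· * _) (NNReal.eq (Real.coe_toNNReal _ (sq_nonneg _)))
    have hsub := HasSubgaussianMGF.sum_of_iIndepFun hind (s := Finset.univ) fun p _ => hterm p
    rw [← hqa] at hsub
    refine ⟨hsub.integrable_exp_mul n, (hsub.mgf_le n).trans (Real.exp_le_exp.mpr ?_)⟩
    rw [NNReal.coe_sum]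
    have hcoe : ∀ p, ((Real.toNNReal (a p ^ 2) *
        Real.toNNReal (10 * Real.exp 1 * (σ / √n) ^ 2) : NNReal) : ℝ) =
        a p ^ 2 * (10 * Real.exp 1 * σ ^ 2 / n) := fun p => by
      rw [NNReal.coe_mul, Real.coe_toNNReal _ (sq_nonneg _), Real.coe_toNNReal _ (by positivity),
        div_pow, Real.sq_sqrt hn'.le, mul_div_assoc]
    rw [Finset.sum_congr rfl fun p _ => hcoe p, ← Finset.sum_mul]
    calc _ = (∑ p, a p ^ 2) * (5 * Real.exp 1 * σ ^ 2 * n) := by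
          field_simp
          ring
      _ ≤ 2 * (5 * Real.exp 1 * σ ^ 2 * n) := by gcongr
      _ = _ := by ring
  -- Since `x ≤ exp (n x)`, the excess over `L` at any pair of net points is at most `B`. The
  -- summand `log 25` of `L` pays for the at most `25 ^ n` pairs, so `B` has mean at most `1`.
  set B : Ω → ℝ := fun ω => ∑ x ∈ N, ∑ y ∈ N, Real.exp (-(n * L)) * Real.exp (n * q x y ω) with hB
  have hBint : Integrable B P := integrable_finsetSum _ fun x hx => integrable_finsetSum _
    fun y hy => (hmgf x hx y hy).1.const_mul _
  have hpt : ∀ ω, opNorm (X ω) ≤ 4 * (L + B ω) := fun ω => by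
    obtain ⟨x, hx, y, hy, hxy⟩ := exists_net_opNorm_le hN hn (hX.symm ω)
    have h1 : q x y ω - L ≤ Real.exp (-(n * L)) * Real.exp (n * q x y ω) := by
      rw [← Real.exp_add]
      rcases le_total (q x y ω - L) 0 with h | h
      · exact h.trans (Real.exp_pos _).le
      · have := Real.add_one_le_exp (-(n * L) + n * q x y ω)
        nlinarith
    have h2 : Real.exp (-(n * L)) * Real.exp (n * q x y ω) ≤ B ω :=
      (Finset.single_le_sum (f := fun y => Real.exp (-(n * L)) * Real.exp (n * q x y ω))
        (fun y _ => by positivity) hy).trans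
      (Finset.single_le_sum (f := fun x => ∑ y ∈ N, Real.exp (-(n * L)) * Real.exp (n * q x y ω))
        (fun x _ => Finset.sum_nonneg fun y _ => by positivity) hx)
    have h3 : y.ofLp ⬝ᵥ (X ω).mulVec x.ofLp = q x y ω := rfl
    rw [h3] at hxy
    linarith
  have hBle : ∫ ω, B ω ∂P ≤ 1 := by
    rw [hB, integral_finsetSum _ fun x hx => integrable_finsetSum _
      fun y hy => (hmgf x hx y hy).1.const_mul _]
    calc _ ≤ ∑ x ∈ N, ∑ y ∈ N, Real.exp (-(n * L)) * Real.exp (n * (10 * Real.exp 1 * σ ^ 2)) := by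
          refine Finset.sum_le_sum fun x hx => ?_
          rw [integral_finsetSum _ fun y hy => (hmgf x hx y hy).1.const_mul _]
          refine Finset.sum_le_sum fun y hy => ?_
          rw [integral_const_mul]
          gcongr
          exact (hmgf x hx y hy).2
      _ = (N.card : ℝ) * N.card * Real.exp (-(n * Real.log 25)) := by
          simp only [Finset.sum_const, nsmul_eq_mul, ← mul_assoc]
          rw [mul_assoc _ (Real.exp _), ← Real.exp_add, hL]
          ring_nf
      _ ≤ 5 ^ n * 5 ^ n * Real.exp (-(n * Real.log 25)) := by
          have : (N.card : ℝ) ≤ 5 ^ n := by exact_mod_cast hNcard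
          gcongr
      _ = 1 := by
          rw [Real.exp_neg, mul_comm (n : ℝ), Real.exp_mul, Real.exp_log (by norm_num),
            Real.rpow_natCast, ← mul_pow]
          norm_num
  calc ∫ ω, opNorm (X ω) ∂P ≤ ∫ ω, 4 * (L + B ω) ∂P :=
        integral_mono (hX.memLp_opNorm.integrable one_le_two)
          (((integrable_const L).add hBint).const_mul 4) hpt
    _ = 4 * (L + ∫ ω, B ω ∂P) := by
        rw [integral_const_mul, integral_add (integrable_const L) hBint]
        simp
    _ ≤ _ := by gcongr

end RandomMatrix

/-- The operator norm is at most three times its mean with high probability. -/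
theorem exists_opNorm_le_three_mul_integral (σ : ℝ) {δ : ℝ} (hδ : 0 < δ) :
    ∃ N : ℕ, ∀ n : ℕ, N ≤ n → ∀ {Ω : Type*} [MeasurableSpace Ω] (P : Measure Ω)
      [IsProbabilityMeasure P] (X : Ω → Matrix (Fin n) (Fin n) ℝ), IsSymmetricIID σ P X →
      P {ω | ¬ opNorm (X ω) ≤ 3 * ∫ ω, opNorm (X ω) ∂P} ≤ ENNReal.ofReal δ := by
  -- A variance of at most `1/2` forces `M ^ 2 ≥ 1/2`, so Chebyshev at distance `2 M` costs at most
  -- `τ / 2`.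
  set τ : ℝ := min δ (1 / 2) with hτ
  have hτ0 : 0 < τ := by positivity
  set θ : ℝ := τ / 4 with hθ
  have hθ0 : 0 < θ := by positivity
  obtain ⟨N, hN⟩ := exists_nat_ge (27648 * σ ^ 6 / θ ^ 2 / (τ / 2))
  refine ⟨N + 1, fun n hn Ω _ P _ X hX => ?_⟩
  have hn0 : 0 < n := by omega
  have hn' : (0 : ℝ) < n := by exact_mod_cast hn0
  have hNn : (N : ℝ) ≤ n := by exact_mod_cast (by omega : N ≤ n)
  have hvar : variance (fun ω => opNorm (X ω)) P ≤ τ := by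
    refine (hX.variance_opNorm_le hn0 hθ0).trans ?_
    have h1 : 27648 * σ ^ 6 / (θ ^ 2 * n) ≤ τ / 2 := by
      rw [← div_div, div_le_comm₀ hn' (by positivity)]
      exact hN.trans hNn
    rw [hθ] at *
    linarith
  set M := ∫ ω, opNorm (X ω) ∂P with hM
  have hM0 : 0 ≤ M := integral_nonneg fun ω => opNorm_nonneg _
  have hM2 : 1 / 2 ≤ M ^ 2 := by
    have h1 := variance_eq_sub hX.memLp_opNorm
    have h2 := hX.one_le_integral_sq_opNorm hn0
    have h3 : τ ≤ 1 / 2 := min_le_right _ _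
    simp only [Pi.pow_apply] at h1
    linarith
  have hMpos : 0 < M := by nlinarith
  calc P {ω | ¬ opNorm (X ω) ≤ 3 * M} ≤ P {ω | 2 * M ≤ |opNorm (X ω) - M|} := by
        refine measure_mono fun ω hω => ?_
        simp only [Set.mem_ofPred_eq, not_le] at hω ⊢
        exact le_trans (by linarith) (le_abs_self _)
    _ ≤ ENNReal.ofReal (variance (fun ω => opNorm (X ω)) P / (2 * M) ^ 2) :=
        meas_ge_le_variance_div_sq hX.memLp_opNorm (by positivity)
    _ ≤ ENNReal.ofReal δ := by
        refine ENNReal.ofReal_le_ofReal ?_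
        rw [div_le_iff₀ (by positivity)]
        have : τ ≤ δ := min_le_left _ _
        nlinarith

/-! ## Sampling from the squared entries of a vector -/

theorem sum_sq_pos {n : ℕ} {w : Fin n → ℝ} (hw : w ≠ 0) : 0 < ∑ i, w i ^ 2 := by
  obtain ⟨i, hi⟩ := Function.ne_iff.mp hw
  exact Finset.sum_pos' (fun _ _ => sq_nonneg _) ⟨i, Finset.mem_univ i, sq_pos_of_ne_zero hi⟩

theorem squareLaw_none {n : ℕ} {w : Fin n → ℝ} (hw : w ≠ 0) : squareLaw w none = 0 := by
  rw [squareLaw, dif_neg hw, PMF.apply_eq_zero_iff, PMF.mem_support_map_iff]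
  rintro ⟨i, -, h⟩
  exact absurd h (by simp)

theorem ne_zero_of_mem_support_squareLaw {n : ℕ} {w : Fin n → ℝ} {i : Fin n}
    (hi : some i ∈ (squareLaw w).support) : w i ≠ 0 := by
  intro h0
  by_cases hw : w = 0
  · rw [squareLaw, dif_pos hw] at hi
    simp at hi
  · rw [squareLaw, dif_neg hw, PMF.mem_support_map_iff] at hi
    obtain ⟨j, hj, hji⟩ := hi
    obtain rfl := Option.some.inj hji
    rw [PMF.mem_support_normalize_iff] at hj
    exact hj (by simp [h0])

theorem squareLaw_compl_le {n : ℕ} {w : Fin n → ℝ} (hw : w ≠ 0) {Q : Finset (Fin n)} {c : ℝ}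
    (h : ∑ i ∈ Qᶜ, w i ^ 2 ≤ c * ∑ i, w i ^ 2) :
    (squareLaw w).toOuterMeasure {o | ∃ i, o = some i ∧ i ∉ Q} ≤ ENNReal.ofReal c := by
  have hpos := sum_sq_pos hw
  have hset : (some ⁻¹' {o | ∃ i, o = some i ∧ i ∉ Q} : Set (Fin n)) = ↑(Qᶜ : Finset (Fin n)) := by
    ext i; simp
  rw [squareLaw, dif_neg hw, PMF.toOuterMeasure_map_apply, hset, PMF.toOuterMeasure_apply_finset]
  simp only [PMF.normalize_apply]
  rw [← Finset.sum_mul, tsum_fintype, ← ENNReal.ofReal_sum_of_nonneg fun i _ => sq_nonneg (w i),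
    ← ENNReal.ofReal_sum_of_nonneg fun i _ => sq_nonneg (w i), ← div_eq_mul_inv,
    ← ENNReal.ofReal_div_of_pos hpos]
  exact ENNReal.ofReal_le_ofReal ((div_le_iff₀ hpos).mpr h)

theorem sum_compl_le_sum_compl_sdiff {n : ℕ} (Q S : Finset (Fin n)) (w : Fin n → ℝ) :
    ∑ i ∈ Qᶜ, w i ^ 2 ≤ ∑ i ∈ (Q \ S)ᶜ, w i ^ 2 :=
  Finset.sum_le_sum_of_subset_of_nonneg (Finset.compl_subset_compl.mpr Finset.sdiff_subset)
    fun _ _ _ => sq_nonneg _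

/-! ## The exact algorithm -/

/-- The exact test never stops wrongly, so `η = 0`; only removals are counted, so `t` bounds both
removals and steps. -/
theorem exactClean_compl_goodOutcome_le {n : ℕ} {X Y : Matrix (Fin n) (Fin n) ℝ} (hY : Y.IsSymm)
    {Q : Finset (Fin n)} (hQ : SupportedOnMinor Q (Y - X)) {M C : ℝ} (hM0 : 0 ≤ M)
    (hM : opNorm X ≤ 3 * M) (hC : 5 * M ≤ C) {top : Matrix (Fin n) (Fin n) ℝ → Fin n → ℝ}
    (htop : ∀ A : Matrix (Fin n) (Fin n) ℝ, A.IsSymm → IsTopEigenvector A (top A)) (t : ℕ) :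
    (exactClean top (5 * M) Y).toOuterMeasure (goodOutcome Y C t t)ᶜ ≤
      2 ^ Q.card * (3 / 4) ^ t := by
  have hne : ∀ S, top (zeroOut S Y) ≠ 0 := fun S h0 => by
    have := (htop _ (zeroOut_isSymm S hY)).1
    simp [h0] at this
  have h := cleanLoop_compl_goodOutcome_le (Y := Y) (Q := Q) (C := C) (η := 0) (c₁ := 0) (c := 1)
    (test := exactTest top (5 * M)) ?_ ?_ ?_ ?_ (n + 1) t ∅ (by simp)
  · simpa [exactClean, zeroOut_empty] using h
  · intro S r hr
    rw [exactTest] at hr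
    split_ifs at hr
    · rw [Rand.ret, PMF.mem_support_pure_iff] at hr
      simp [hr]
    · rw [Rand.draw, PMF.mem_support_map_iff] at hr
      obtain ⟨a, -, rfl⟩ := hr
      simp
  · intro S r hr i hri hiS
    rw [exactTest] at hr
    split_ifs at hr with hK
    · rw [Rand.ret, PMF.mem_support_pure_iff] at hr
      simp [hr] at hri
    · rw [Rand.draw, PMF.mem_support_map_iff] at hr
      obtain ⟨a, ha, rfl⟩ := hr
      dsimp only at hri
      subst hri
      -- On a zeroed row the eigenvalue equation reads `0 = m * v i`, and `|m| > 5 M ≥ 0`; so no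
      -- index is drawn twice.
      refine ne_zero_of_mem_support_squareLaw ha ?_
      obtain ⟨m, hm, hmA⟩ := (htop _ (zeroOut_isSymm S hY)).exists_abs_eq_opNorm
        (zeroOut_isSymm S hY)
      have h1 := congrFun hm i
      rw [zeroOut_mulVec_of_mem Y _ hiS, Pi.smul_apply, smul_eq_mul] at h1
      rcases mul_eq_zero.mp h1.symm with h2 | h2
      · rw [h2, abs_zero] at hmA
        exact absurd (by linarith) hK
      · exact h2
  · intro S hCS
    rw [exactTest, if_neg (by linarith), Rand.draw, PMF.toOuterMeasure_map_apply]
    have hset : ((fun a : Option (Fin n) => (a, 0)) ⁻¹' {r : Option (Fin n) × ℕ | r.1 = none}) =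
        {none} := by
      ext a; simp
    rw [hset, PMF.toOuterMeasure_apply_singleton, squareLaw_none (hne S)]
  · intro S
    rw [exactTest]
    split_ifs with hK
    · rw [Rand.ret, PMF.toOuterMeasure_pure_apply, if_neg (by simp)]
      exact zero_le
    · rw [Rand.draw, PMF.toOuterMeasure_map_apply]
      have hv := htop _ (zeroOut_isSymm S hY)
      refine (squareLaw_compl_le (hne S) (c := 1 / 2) ?_).trans (by simp)
      rw [hv.1, mul_one]
      exact (sum_compl_le_sum_compl_sdiff Q S _).trans
        (sum_sq_topEigenvector_compl_le hY hQ hM (not_le.mp hK) hv)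

/-! ## The algorithm with power iteration -/

theorem dotT_val {n : ℕ} (u v : Fin n → ℝ) : (dotT u v).val = u ⬝ᵥ v := rfl

theorem dotT_cost {n : ℕ} (u v : Fin n → ℝ) : (dotT u v).cost = 2 * n := by
  simp [dotT, Timed.forSum, Timed.step, mul_comm]

theorem mulVecT_val {n : ℕ} (A : Matrix (Fin n) (Fin n) ℝ) (v : Fin n → ℝ) :
    (mulVecT A v).val = A.mulVec v := rfl

theorem mulVecT_cost {n : ℕ} (A : Matrix (Fin n) (Fin n) ℝ) (v : Fin n → ℝ) :
    (mulVecT A v).cost = n * (2 * n + 1) := by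
  simp [mulVecT, Timed.forVec, dotT_cost]

theorem powerT_val {n : ℕ} (A : Matrix (Fin n) (Fin n) ℝ) (k : ℕ) (w : Fin n → ℝ) :
    (powerT A k w).val = A.mulVec^[k] w := by
  induction k generalizing w with
  | zero => rfl
  | succ k ih => exact ih (A.mulVec w)

theorem powerT_cost {n : ℕ} (A : Matrix (Fin n) (Fin n) ℝ) (k : ℕ) (w : Fin n → ℝ) :
    (powerT A k w).cost = k * (n * (2 * n + 1) + 1) := by
  induction k generalizing w with
  | zero => simp [powerT, Timed.ret]
  | succ k ih =>
    simp only [powerT, Timed.bind, Timed.step, mulVecT_cost, ih]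
    ring

theorem exceedsT_cost {n : ℕ} (K : ℝ) (A : Matrix (Fin n) (Fin n) ℝ) (w : Fin n → ℝ) :
    (exceedsT K A w).cost = n * (2 * n + 1) + 4 * n + 3 := by
  simp only [exceedsT, Timed.bind, Timed.step, mulVecT_cost, dotT_cost]
  ring

theorem exceedsT_val {n : ℕ} (K : ℝ) (A : Matrix (Fin n) (Fin n) ℝ) (w : Fin n → ℝ) :
    (exceedsT K A w).val = true ↔ K ^ 2 * ∑ i, w i ^ 2 < ∑ i, A.mulVec w i ^ 2 := by
  simp only [exceedsT, Timed.bind, Timed.step, mulVecT_val, dotT_val, dotProduct, sq]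
  exact decide_eq_true_iff

/-- The number of rounds of the power iteration. -/
def rounds (n : ℕ) : ℕ := 100 * (Nat.clog 2 n + 1)

/-- The steps of one test up to the decision. -/
def decisionCost (n : ℕ) : ℕ :=
  n + rounds n + rounds n * (n * (2 * n + 1) + 1) + (n * (2 * n + 1) + 4 * n + 3)

open Classical in
theorem powerTest_eq {n : ℕ} (K : ℝ) (A : Matrix (Fin n) (Fin n) ℝ) :
    powerTest K A = (startLaw n).bind fun g =>
      if K ^ 2 * iterSq A g (rounds n) < iterSq A g (rounds n + 1) then
        (squareLaw (A.mulVec^[rounds n] g)).map fun o => (o, decisionCost n + (3 * n + 1))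
      else PMF.pure (none, decisionCost n) := by
  simp only [powerTest, Rand.bind, Rand.draw, Rand.lift, PMF.bind_map, PMF.pure_bind, roundsT,
    Function.comp_def]
  congr 1
  ext1 g
  have hval := exceedsT_val K A (A.mulVec^[rounds n] g)
  have hit : ∑ i, A.mulVec (A.mulVec^[rounds n] g) i ^ 2 = iterSq A g (rounds n + 1) := by
    simp only [iterSq, Function.iterate_succ_apply' A.mulVec]
  rw [hit] at hval
  change _ ↔ K ^ 2 * iterSq A g (rounds n) < _ at hval
  have hr : 100 * (Nat.clog 2 n + 1) = rounds n := rfl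
  simp only [powerT_val, powerT_cost, exceedsT_cost, hr]
  by_cases h : K ^ 2 * iterSq A g (rounds n) < iterSq A g (rounds n + 1)
  · rw [if_pos h, if_pos (hval.mpr h)]
    simp only [PMF.map_comp, Function.comp_def, decisionCost]
    congr 1
    ext1 o
    congr 1
    ring
  · rw [if_neg h, if_neg (mt hval.mp h)]
    simp only [Rand.ret, PMF.pure_map, decisionCost]
    congr 2
    ring

/-- From a good start the growth ratio is at least `0.81 ‖A‖² > K²`, because `0.81 * 4 > 1`; only a
bad start can cause a wrong stop. -/
theorem powerTest_none_le {n : ℕ} (hn : 2 ≤ n) {A : Matrix (Fin n) (Fin n) ℝ} (hA : A.IsSymm)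
    {K : ℝ} (hK : 0 ≤ K) (hAK : 2 * K < opNorm A) :
    (powerTest K A).toOuterMeasure {r | r.1 = none} ≤ ((n : ℝ≥0∞) ^ 2 + 1)⁻¹ := by
  classical
  obtain ⟨u, m, hu, hm, hmA⟩ := exists_unit_eigenvector (by omega : 0 < n) hA
  have hm2 : m ^ 2 = opNorm A ^ 2 := by rw [← hmA, sq_abs]
  rw [powerTest_eq]
  refine (toOuterMeasure_bind_le _ _ _ {g | (u ⬝ᵥ g) ^ 2 < 1 / (4 * (n : ℝ))} 0 ?_).trans
    (by rw [add_zero]; exact startLaw_dotProduct_sq_lt hu)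
  intro g hg hgood
  rw [Set.mem_ofPred_eq, not_lt] at hgood
  have hlow := pow_mul_dotProduct_sq_le_iterSq hA hu hm g (rounds n)
  have hgrow := mul_iterSq_le_iterSq_succ hn hA hu hm (sum_sq_le_of_mem_support_startLaw hg) hgood
    (j := rounds n) (by simp only [rounds]; omega)
  have hmpos : 0 < m ^ 2 := by rw [hm2]; exact pow_pos (by linarith) 2
  have hnpos : (0 : ℝ) < n := by exact_mod_cast (by omega : 0 < n)
  have hq : 0 < iterSq A g (rounds n) :=
    lt_of_lt_of_le (mul_pos (pow_pos hmpos _) (lt_of_lt_of_le (by positivity) hgood)) hlow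
  have hexc : K ^ 2 * iterSq A g (rounds n) < iterSq A g (rounds n + 1) := by
    refine lt_of_lt_of_le ?_ hgrow
    refine mul_lt_mul_of_pos_right ?_ hq
    rw [hm2]
    nlinarith
  rw [if_pos hexc, PMF.toOuterMeasure_map_apply]
  have hset : ((fun o : Option (Fin n) => (o, decisionCost n + (3 * n + 1))) ⁻¹'
      {r : Option (Fin n) × ℕ | r.1 = none}) = {none} := by
    ext a; simp
  rw [hset, PMF.toOuterMeasure_apply_singleton, squareLaw_none]
  intro h0
  simp [iterSq, h0] at hq

/-- The sampled `w` is `A w'` for the previous iterate `w'`, so its mass outside `Q` is at most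
`‖X‖² ‖w'‖²`. A passed test gives `‖A‖ ≥ 5 M`, and `‖w‖² ≥ 0.81 ‖A‖² ‖w'‖²` from a good start; the
quotient is `(9/25) / (81/100) = 4/9`. -/
theorem powerTest_out_le {n : ℕ} (hn : 5 ≤ n) {X Y : Matrix (Fin n) (Fin n) ℝ} (hY : Y.IsSymm)
    {Q : Finset (Fin n)} (hQ : SupportedOnMinor Q (Y - X)) {M : ℝ}
    (hM : opNorm X ≤ 3 * M) (S : Finset (Fin n)) :
    (powerTest (5 * M) (zeroOut S Y)).toOuterMeasure {r | ∃ i, r.1 = some i ∧ i ∉ Q} ≤ 2⁻¹ := by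
  classical
  set A := zeroOut S Y with hAdef
  have hA : A.IsSymm := zeroOut_isSymm S hY
  obtain ⟨u, m, hu, hm, hmA⟩ := exists_unit_eigenvector (by omega : 0 < n) hA
  have hm2 : m ^ 2 = opNorm A ^ 2 := by rw [← hmA, sq_abs]
  rw [powerTest_eq]
  refine (toOuterMeasure_bind_le _ _ _ {g | (u ⬝ᵥ g) ^ 2 < 1 / (4 * (n : ℝ))}
    (ENNReal.ofReal (4 / 9)) ?_).trans ?_
  · intro g hg hgood
    rw [Set.mem_ofPred_eq, not_lt] at hgood
    split_ifs with hexc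
    · obtain ⟨k, hk⟩ : ∃ k, rounds n = k + 1 := ⟨100 * Nat.clog 2 n + 99, by simp only [rounds]; ring⟩
      have hgrow := mul_iterSq_le_iterSq_succ (by omega) hA hu hm
        (sum_sq_le_of_mem_support_startLaw hg) hgood (j := k) (by simp only [rounds] at hk; omega)
      have hup := iterSq_succ_le A g (rounds n)
      rw [hk] at hexc hup ⊢
      have hq0 := iterSq_nonneg A g k
      have hq1 := iterSq_nonneg A g (k + 1)
      have hq1pos : 0 < iterSq A g (k + 1) := by
        refine lt_of_le_of_ne hq1 fun h0 => ?_
        rw [← h0] at hexc hup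
        linarith
      have hAM : (5 * M) ^ 2 ≤ m ^ 2 := by
        rw [hm2]
        exact (lt_of_mul_lt_mul_right (hexc.trans_le hup) hq1).le
      have hne : A.mulVec^[k + 1] g ≠ 0 := fun h0 => by simp [iterSq, h0] at hq1pos
      have hX2 : opNorm X ^ 2 ≤ (3 * M) ^ 2 := pow_le_pow_left₀ (opNorm_nonneg X) hM 2
      rw [PMF.toOuterMeasure_map_apply]
      refine squareLaw_compl_le hne ?_
      refine (sum_compl_le_sum_compl_sdiff Q S _).trans ?_
      rw [Function.iterate_succ_apply' A.mulVec]
      refine (sum_sq_zeroOut_mulVec_compl_le hQ S _).trans ?_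
      rw [← Function.iterate_succ_apply' A.mulVec]
      change opNorm X ^ 2 * iterSq A g k ≤ 4 / 9 * iterSq A g (k + 1)
      have h1 : opNorm X ^ 2 ≤ 9 / 25 * m ^ 2 := by nlinarith
      have h2 := mul_le_mul_of_nonneg_right h1 hq0
      linarith
    · rw [PMF.toOuterMeasure_pure_apply, if_neg (by simp)]
      exact zero_le
  -- The slack `1/2 - 4/9 = 1/18` covers the bad starts once `n ≥ 5`.
  · have hη : ((n : ℝ≥0∞) ^ 2 + 1)⁻¹ ≤ ENNReal.ofReal (1 / 18) := by
      rw [ENNReal.inv_le_iff_inv_le, ← ENNReal.ofReal_inv_of_pos (by norm_num)]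
      have h5 : (25 : ℝ≥0∞) ≤ (n : ℝ≥0∞) ^ 2 := by
        exact_mod_cast Nat.pow_le_pow_left hn 2
      calc ENNReal.ofReal (1 / 18)⁻¹ ≤ ENNReal.ofReal 25 := by
            apply ENNReal.ofReal_le_ofReal; norm_num
        _ = 25 := by simp
        _ ≤ (n : ℝ≥0∞) ^ 2 := h5
        _ ≤ _ := le_self_add
    calc _ ≤ ENNReal.ofReal (1 / 18) + ENNReal.ofReal (4 / 9) := by
          gcongr
          exact (startLaw_dotProduct_sq_lt hu).trans hη
      _ = ENNReal.ofReal (1 / 2) := by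
          rw [← ENNReal.ofReal_add (by norm_num) (by norm_num)]; norm_num
      _ = _ := by simp

/-- A bound on the number of steps of a run with at most `t` removals. -/
def runCost (n t : ℕ) : ℕ :=
  n ^ 2 + ((t + 1) * (decisionCost n + (3 * n + 1)) + t * (2 * n))

theorem powerClean_compl_goodOutcome_le {n : ℕ} (hn : 5 ≤ n) {X Y : Matrix (Fin n) (Fin n) ℝ}
    (hY : Y.IsSymm) {Q : Finset (Fin n)} (hQ : SupportedOnMinor Q (Y - X)) {M C : ℝ} (hM0 : 0 ≤ M)
    (hM : opNorm X ≤ 3 * M) (hC : 2 * (5 * M) ≤ C) (t : ℕ) :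
    (powerClean (5 * M) Y).toOuterMeasure (goodOutcome Y C t (runCost n t))ᶜ ≤
      2 ^ Q.card * (3 / 4) ^ t + (n + 1) * ((n : ℝ≥0∞) ^ 2 + 1)⁻¹ := by
  classical
  have h := cleanLoop_compl_goodOutcome_le (Y := Y) (Q := Q) (C := C)
    (η := ((n : ℝ≥0∞) ^ 2 + 1)⁻¹) (c₁ := decisionCost n + (3 * n + 1)) (c := 2 * n)
    (test := powerTest (5 * M)) ?_ ?_ ?_ ?_ (n + 1) t ∅ (by simp)
  · rw [zeroOut_empty, Finset.sdiff_empty, Finset.card_empty, zero_add] at h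
    push_cast at h
    refine le_trans ?_ h
    rw [powerClean, Rand.bind, Rand.lift, PMF.pure_bind, PMF.toOuterMeasure_map_apply]
    refine OuterMeasure.mono _ ?_
    rw [Set.preimage_compl, Set.compl_subset_compl]
    rintro ⟨B, s⟩ ⟨hs, S', hS', hB, hBC⟩
    exact ⟨Nat.add_le_add_left hs _, S', hS', hB, hBC⟩
  · intro S r hr
    rw [powerTest_eq, PMF.mem_support_bind_iff] at hr
    obtain ⟨g, -, hr⟩ := hr
    split_ifs at hr
    · rw [PMF.mem_support_map_iff] at hr
      obtain ⟨a, -, rfl⟩ := hr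
      rfl
    · rw [PMF.mem_support_pure_iff] at hr
      simp [hr]
  · intro S r hr i hri hiS
    rw [powerTest_eq, PMF.mem_support_bind_iff] at hr
    obtain ⟨g, -, hr⟩ := hr
    split_ifs at hr
    · rw [PMF.mem_support_map_iff] at hr
      obtain ⟨a, ha, rfl⟩ := hr
      dsimp only at hri
      subst hri
      refine ne_zero_of_mem_support_squareLaw ha ?_
      -- At least one round is made, so `w` lies in the range of the cleaned matrix and vanishes on
      -- `S`.
      have hk : rounds n = (100 * Nat.clog 2 n + 99) + 1 := by simp only [rounds]; ring
      rw [hk, Function.iterate_succ_apply']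
      exact zeroOut_mulVec_of_mem Y _ hiS
    · rw [PMF.mem_support_pure_iff] at hr
      simp [hr] at hri
  · intro S hCS
    exact powerTest_none_le (by omega) (zeroOut_isSymm S hY) (by linarith) (by linarith)
  · exact powerTest_out_le hn hY hQ hM

theorem runCost_le {n t : ℕ} (hn : 3 ≤ n) {e : ℝ} (he : 1 ≤ e) (ht : (t : ℝ) ≤ 4 * e) :
    (runCost n t : ℝ) ≤ 10100 * (e * (n : ℝ) ^ 2 * Real.log n) := by
  have hn' : (3 : ℝ) ≤ n := by exact_mod_cast hn
  set l := Real.log n with hl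
  have hl1 : 1 ≤ l := by
    rw [hl, Real.le_log_iff_exp_le (by linarith)]
    exact Real.exp_one_lt_three.le.trans hn'
  have hclog : (Nat.clog 2 n : ℝ) ≤ 1 + 2 * l := by
    have h1 : 2 ^ (Nat.clog 2 n).pred < n := Nat.pow_pred_clog_lt_self one_lt_two (by omega)
    have h2 : ((Nat.clog 2 n).pred : ℝ) * Real.log 2 ≤ l := by
      rw [← Real.log_pow]
      exact Real.log_le_log (by positivity) (by exact_mod_cast h1.le)
    have h3 : (Nat.clog 2 n : ℝ) ≤ (Nat.clog 2 n).pred + 1 := by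
      exact_mod_cast (by rw [Nat.pred_eq_sub_one]; omega :
        Nat.clog 2 n ≤ (Nat.clog 2 n).pred + 1)
    have h4 := Real.log_two_gt_d9
    have h5 : (0 : ℝ) ≤ (Nat.clog 2 n).pred := by positivity
    nlinarith
  have hR : (rounds n : ℝ) ≤ 400 * l := by
    simp only [rounds]
    push_cast
    linarith
  have hR0 : (0 : ℝ) ≤ rounds n := by positivity
  have hnn : (n : ℝ) ≤ n ^ 2 / 3 := by nlinarith
  have hd : (decisionCost n + (3 * n + 1) : ℝ) ≤ 2015 * (n ^ 2 * l) := by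
    simp only [decisionCost]
    push_cast
    have h1 : (rounds n : ℝ) * (n * (2 * n + 1) + 1 + 1) ≤ 400 * l * (4 * n ^ 2) := by
      gcongr
      nlinarith
    have h2 : (n : ℝ) ^ 2 ≤ n ^ 2 * l := le_mul_of_one_le_right (by positivity) hl1
    nlinarith
  have ht0 : (0 : ℝ) ≤ t := by positivity
  set s := (n : ℝ) ^ 2 * l with hs
  have hs0 : (n : ℝ) ^ 2 ≤ s := le_mul_of_one_le_right (by positivity) hl1
  have hspos : 0 ≤ s := le_trans (by positivity) hs0
  simp only [runCost]
  push_cast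
  calc (n : ℝ) ^ 2 + ((t + 1) * (decisionCost n + (3 * n + 1)) + t * (2 * n))
      -- Here `t + 1 ≤ 5 e` uses `e ≥ 1`.
      ≤ s + (5 * e * (2015 * s) + 4 * e * s) := by
        gcongr ?_ + (?_ + ?_)
        · refine mul_le_mul (by linarith) hd (by positivity) (by linarith)
        · refine mul_le_mul ht (by nlinarith) (by positivity) (by linarith)
    _ ≤ 10100 * (e * s) := by nlinarith
    _ = _ := by rw [hs]; ring

/-! ## Success probabilities -/

theorem le_successProb {n : ℕ} {p : Rand (Option (Matrix (Fin n) (Fin n) ℝ))}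
    {Y : Matrix (Fin n) (Fin n) ℝ} {ε C s δ : ℝ} (hδ : 0 ≤ δ) {t b : ℕ}
    (ht : (t : ℝ) ≤ 4 * ε * n)
    (hb : (b : ℝ) ≤ s) (h : p.toOuterMeasure (goodOutcome Y C t b)ᶜ ≤ ENNReal.ofReal δ) :
    ENNReal.ofReal (1 - δ) ≤ successProb p Y ε C s := by
  have h1 := toOuterMeasure_add_compl p (goodOutcome Y C t b)
  have h2 : p.toOuterMeasure (goodOutcome Y C t b) ≤ successProb p Y ε C s := by
    refine OuterMeasure.mono _ ?_
    rintro ⟨B, c⟩ ⟨hc, S, hS, hB, hBC⟩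
    exact ⟨le_trans (Nat.cast_le.mpr hc) hb, _, hB,
      ⟨S, le_trans (Nat.cast_le.mpr hS) ht, rfl⟩, hBC⟩
  refine le_trans ?_ h2
  rw [ENNReal.ofReal_sub _ hδ, ENNReal.ofReal_one, tsub_le_iff_right, ← h1]
  gcongr

/-- Four removals per corrupted index suffice because `2 * (3/4) ^ 4 = 81/128 < 1`. -/
theorem exists_two_pow_mul_three_quarters_pow_le {δ : ℝ} (hδ : 0 < δ) :
    ∃ N : ℕ, ∀ q : ℕ, N ≤ q → ∀ m : ℕ, m ≤ q →
      (2 : ℝ≥0∞) ^ m * (3 / 4) ^ (4 * q) ≤ ENNReal.ofReal δ := by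
  obtain ⟨N, hN⟩ := exists_pow_lt_of_lt_one hδ (by norm_num : (81 / 128 : ℝ) < 1)
  refine ⟨N, fun q hq m hm => ?_⟩
  have h34 : (3 / 4 : ℝ≥0∞) = ENNReal.ofReal (3 / 4) := by
    rw [ENNReal.ofReal_div_of_pos (by norm_num)]; simp
  have h2 : (2 : ℝ≥0∞) = ENNReal.ofReal 2 := by simp
  calc (2 : ℝ≥0∞) ^ m * (3 / 4) ^ (4 * q) ≤ 2 ^ q * (3 / 4) ^ (4 * q) := by
        gcongr
        exact one_le_two
    _ = ENNReal.ofReal ((81 / 128) ^ q) := by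
        rw [h34, h2, ← ENNReal.ofReal_pow (by norm_num), ← ENNReal.ofReal_pow (by norm_num),
          ← ENNReal.ofReal_mul (by positivity), pow_mul, ← mul_pow]
        norm_num
    _ ≤ ENNReal.ofReal δ := by
        refine ENNReal.ofReal_le_ofReal (le_trans ?_ hN.le)
        exact pow_le_pow_of_le_one (by norm_num) (by norm_num) hq

theorem exists_add_one_mul_inv_le {δ : ℝ} (hδ : 0 < δ) :
    ∃ N : ℕ, ∀ n : ℕ, N ≤ n → ((n : ℝ≥0∞) + 1) * ((n : ℝ≥0∞) ^ 2 + 1)⁻¹ ≤ ENNReal.ofReal δ := by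
  obtain ⟨N, hN⟩ := exists_nat_ge (2 / δ)
  refine ⟨N + 1, fun n hn => ?_⟩
  have hNn : (N : ℝ) ≤ n := by exact_mod_cast (by omega : N ≤ n)
  have hn1 : (1 : ℝ) ≤ n := by exact_mod_cast (by omega : 1 ≤ n)
  have e : ((n : ℝ≥0∞) + 1) * ((n : ℝ≥0∞) ^ 2 + 1)⁻¹ =
      ENNReal.ofReal ((n + 1) / ((n : ℝ) ^ 2 + 1)) := by
    rw [ENNReal.ofReal_div_of_pos (by positivity), ENNReal.ofReal_add (by positivity) one_pos.le,
      ENNReal.ofReal_add (by positivity) one_pos.le, ENNReal.ofReal_pow (by positivity)]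
    simp [div_eq_mul_inv]
  rw [e]
  refine ENNReal.ofReal_le_ofReal ?_
  have h2 : 2 ≤ n * δ := by
    rw [← div_le_iff₀ hδ]; exact hN.trans hNn
  rw [div_le_iff₀ (by positivity)]
  nlinarith

end SpectralCleaning

open SpectralCleaning in
theorem mainTheorem2 (σ : ℝ) :
    ∃ C : ℝ, 0 < C ∧ ∀ δ : ℝ, 0 < δ → ∃ N : ℕ, ∀ n : ℕ, N ≤ n → ∀ ε : ℝ, (N : ℝ) ≤ ε * n →
      ∀ {Ω : Type*} [MeasurableSpace Ω] (P : Measure Ω) [IsProbabilityMeasure P]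
        (X : Ω → Matrix (Fin n) (Fin n) ℝ), IsSymmetricIID σ P X →
        ∀ K : ℝ, K = 5 * ∫ ω, opNorm (X ω) ∂P →
          P {ω | ¬ ∀ Y : Matrix (Fin n) (Fin n) ℝ, Y.IsSymm →
              IsPrincipalMinorCorruption ε (X ω) Y →
              -- the algorithm with an arbitrary rule that returns exact top eigenvectors
              (∀ top : Matrix (Fin n) (Fin n) ℝ → Fin n → ℝ,
                (∀ A : Matrix (Fin n) (Fin n) ℝ, A.IsSymm → IsTopEigenvector A (top A)) →
                ENNReal.ofReal (1 - δ) ≤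
                  successProb (exactClean top K Y) Y ε C (4 * ε * n)) ∧
              -- the algorithm with power iteration, and its running time
              ENNReal.ofReal (1 - δ) ≤
                successProb (powerClean K Y) Y ε C (C * (ε * (n : ℝ) ^ 3 * Real.log n)) ∧
              -- the probability of selecting a surviving corrupted index
              (∀ Q S : Finset (Fin n), SupportedOnMinor Q (Y - X ω) →
                K < opNorm (zeroOut S Y) →
                ∀ v : Fin n → ℝ, IsTopEigenvector (zeroOut S Y) v →
                  1 / 2 - δ ≤ ∑ i ∈ Q \ S, v i ^ 2)}
            ≤ ENNReal.ofReal δ := by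
  set C₀ : ℝ := 4 * (Real.log 25 + 10 * Real.exp 1 * σ ^ 2 + 1) with hC₀
  have hC₀pos : 0 < C₀ := by
    have : 0 < Real.log 25 := Real.log_pos (by norm_num)
    positivity
  -- One constant serves both the running time (`10100`) and the final norm (`2 K = 10 M ≤ 10 C₀`).
  refine ⟨10100 + 10 * C₀, by positivity, fun δ hδ => ?_⟩
  obtain ⟨N₁, hN₁⟩ := exists_opNorm_le_three_mul_integral σ hδ
  obtain ⟨N₂, hN₂⟩ := exists_two_pow_mul_three_quarters_pow_le (half_pos hδ)
  obtain ⟨N₃, hN₃⟩ := exists_add_one_mul_inv_le (half_pos hδ)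
  refine ⟨N₁ + N₂ + N₃ + 5, fun n hn ε hε Ω _ P _ X hX K hK => ?_⟩
  refine (measure_mono fun ω hω => ?_).trans (hN₁ n (by omega) P X hX)
  rw [Set.mem_ofPred_eq] at hω ⊢
  contrapose! hω
  set M := ∫ ω, opNorm (X ω) ∂P with hMdef
  have hM0 : 0 ≤ M := integral_nonneg fun ω => opNorm_nonneg _
  have hMC : M ≤ C₀ := hX.integral_opNorm_le (by omega)
  intro Y hY ⟨Q₀, hQcard, hQ₀⟩
  set e := ε * n with he
  -- The integer `q` bounds `|Q₀|`, and `4 q` is the removal budget; it is large because `ε n ≥ N`.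
  set q := ⌊e⌋₊ with hq
  have he1 : 1 ≤ e := le_trans (by exact_mod_cast (by omega : 1 ≤ N₁ + N₂ + N₃ + 5)) hε
  have hNq : N₁ + N₂ + N₃ + 5 ≤ q := Nat.le_floor hε
  have hqe : (q : ℝ) ≤ e := Nat.floor_le (by linarith)
  have hQq : Q₀.card ≤ q := Nat.le_floor hQcard
  have ht : ((4 * q : ℕ) : ℝ) ≤ 4 * e := by push_cast; linarith
  have ht' : ((4 * q : ℕ) : ℝ) ≤ 4 * ε * n := by rw [mul_assoc]; exact ht
  have h1 := hN₂ q (by omega) Q₀.card hQq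
  subst hK
  refine ⟨fun top htop => ?_, ?_, fun Q S hQ hS v hv => ?_⟩
  · refine le_successProb hδ.le ht' ht' ?_
    refine (exactClean_compl_goodOutcome_le hY hQ₀ hM0 hω (by linarith) htop _).trans (h1.trans ?_)
    exact ENNReal.ofReal_le_ofReal (by linarith)
  · refine le_successProb hδ.le ht' (b := runCost n (4 * q)) ?_ ?_
    · refine (runCost_le (by omega) he1 ht).trans ?_
      have hlog : 0 ≤ Real.log n := Real.log_natCast_nonneg n
      have e1 : e * (n : ℝ) ^ 2 * Real.log n = ε * (n : ℝ) ^ 3 * Real.log n := by rw [he]; ring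
      rw [← e1]
      gcongr
      linarith
    · refine (powerClean_compl_goodOutcome_le (by omega) hY hQ₀ hM0 hω (by linarith) _).trans ?_
      refine (add_le_add h1 (hN₃ n (by omega))).trans (le_of_eq ?_)
      rw [← ENNReal.ofReal_add (by positivity) (by positivity), add_halves]
  · have := half_le_sum_sq_topEigenvector hY hQ hω hS hv
    linarith
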